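/- Let $C$ be a compact complex manifold of dimension $n$, covered by finitely many holomorphic charts $\varphi_j:U_j\to\mathbb C^n$ onto polydiscs, with transition functions $\varphi_{kj}=\varphi_k\varphi_j^{-1}$. A (germ of a) holomorphic neighborhood of $C$ of codimension $d$ is given by its transition functions $\Phi=\{\Phi_{kj}\}$: maps $\Phi_{kj}(z_j,w_j)\in\mathbb C^n\times\mathbb C^d$, holomorphic near $\varphi_j(U_k\cap U_j)\times\{0\}$, with $\Phi_{kj}(z,0)=(\varphi_{kj}(z),0)$, $\Phi_{jj}=\mathrm{id}$ and $\Phi_{kj}\Phi_{ji}=\Phi_{ki}$ as germs. $O(m)$ denotes vanishing to order at least $m$ along $w=0$. Fix such a neighborhood $N^1$. Let $g_{kj}(z)=DN^1_{kj}(z,0)$ be the transition functions of $T_CM$, let $t_{kj}$ (the lower right block of $g_{kj}$) be those of the normal bundle $N_C$, and put $N_{kj}(z,w)=(\varphi_{kj}(z),t_{kj}(z)w)$. Let $\mathcal M$ be the set of holomorphic neighborhoods $\Phi=N^1+O(2)$. A formal map is a family $F_j=I+O(2)$ of formal power series in $w_j$ with coefficients holomorphic on $U_j$; write $\Phi\overset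 f\sim\tilde\Phi$ if $F\Phi F^{-1}=\tilde\Phi$, i.e. $F_k\Phi_{kj}=\tilde\Phi_{kj}F_j$ for all $k,j$, for some formal map $F$. Sections of $T_CM\otimes S^\ell N_C^*$ over $U_j$ are identified with maps to $\mathbb C^{n+d}$ that are homogeneous polynomials of degree $\ell$ in $w_j$ with coefficients holomorphic in $z_j$, with coboundary $(\delta f)_{kj}=g_{kj}f_j-f_k\circ N_{kj}$. Put $\mathcal H^q(T_CM)=\bigoplus_{\ell\ge2}H^q(C,T_CM\otimes S^\ell N_C^*)$ and $\widehat{\mathcal H}^1(T_CM)=\prod_{\ell\ge2}H^1(C,T_CM\otimes S^\ell N_C^*)$. For every $\ell$ fix a basis of $H^1(C,T_CM\otimes S^\ell N_C^*)$ and cocycles $e^\ell_i$ representing it; for a class $c$ with coordinates $c_i$ put $c\cdot e^\ell=\sum_i c_ie^\ell_i$. For $\Phi\in\mathcal M$ and $m\ge 1$ let $\operatorname{Aut}_m(\Phi)=\{F=I+O(2): F\Phi F^{-1}=\Phi+O(m+1)\}$. For $m\ge2$ let $\mathcal M_m(\Phi)$ be the set of $\Psi\in\mathcal M$ with $\Psi=\Phi+c\cdot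 e^m+O(m+1)$ for some class $c$. Call $\Psi,\Psi'\in\mathcal M_m(\Phi)$ equivalent if $F\Psi F^{-1}=\Psi'+O(m+1)$ for some $F\in\operatorname{Aut}_{m-1}(\Phi)$. Choose one representative in each equivalence class, $\Phi$ being the representative of its own class; such choices exist. Starting from $N^1$, let $N^m=N^m(c^2,\dots,c^m)$ be a chosen representative in $\mathcal M_m(N^{m-1})$ with $N^m=N^{m-1}+c^m\cdot e^m+O(m+1)$. Let $N^\infty(c^2,c^3,\dots)$ be the formal transition functions that agree with $N^m(c^2,\dots,c^m)$ up to $O(m+1)$ for all $m$, and let $\mathcal N_\infty$ be the set of all of these. **Theorem.** The relation $\overset f\sim$ is an equivalence relation on $\mathcal M$. For all choices as above and every $\Phi\in\mathcal M$ there are a unique sequence $c(\Phi)=(c^2,c^3,\dots)\in\widehat{\mathcal H}^1(T_CM)$ and a unique $N^\infty(\Phi)\in\mathcal N_\infty$ such that $N^\infty(\Phi)=N^\infty(c^2,c^3,\dots)$ and, for every $m\ge 1$, $F\Phi F^{-1}=N^m(c^2,\dots,c^m)+O(m+1)$ for some formal map $F=I+O(2)$ depending on $m$. The sequence $c(\Phi)$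 depends only on the formal equivalence class of $\Phi$, so that $[\Phi]\mapsto c(\Phi)$ is a well-defined map $$\mathfrak C^f:\mathcal M/\overset f\sim\ \longrightarrow\ \widehat{\mathcal H}^1(T_CM).$$ If $\dim\mathcal H^1(T_CM)<\infty$ or $\mathcal H^0(T_CM)=0$, then $\mathfrak C^f$ is injective, and for every $\Phi\in\mathcal M$ there is a formal map $F=I+O(2)$ with $F\Phi F^{-1}=N^\infty(\Phi)$. If $\dim\mathcal H^1(T_CM)<\infty$, then $\mathfrak C^f$ takes values in $\mathcal H^1(T_CM)=\widehat{\mathcal H}^1(T_CM)$. -/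

import Mathlib

open scoped Manifold ContDiff Topology DirectSum
open Set Asymptotics

namespace FormalNbhd

universe u v w

/-- Coordinates `(z, w)` of a neighborhood: `z ∈ ℂⁿ` along `C`, `w ∈ ℂᵈ` normal to `C`. -/
abbrev Coord (n d : ℕ) : Type := (Fin n → ℂ) × (Fin d → ℂ)

/-- A covering of the complex manifold `C` by holomorphic coordinate charts
`φ_i : U_i → ℂⁿ`, each onto a polydisc (hence a Leray covering). -/
structure PolydiscCover (n : ℕ) (C : Type u) [TopologicalSpace C]
    [ChartedSpace (Fin n → ℂ) C] (ι : Type v) where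
  chart : ι → OpenPartialHomeomorph C (Fin n → ℂ)
  mem_maximalAtlas : ∀ i, chart i ∈ IsManifold.maximalAtlas 𝓘(ℂ, Fin n → ℂ) ω C
  polydisc : ∀ i, ∃ (c : Fin n → ℂ) (r : Fin n → ℝ), (∀ a, 0 < r a) ∧
    (chart i).target = Set.univ.pi fun a => Metric.ball (c a) (r a)
  cover : ∀ p : C, ∃ i, p ∈ (chart i).source

/-- `g = O(m)`: `g(z, w) = O(|w|^m)` locally uniformly along `A × {0}`. For a `g` that is
holomorphic near `A × {0}` this says that `g` vanishes to order `≥ m` along `w = 0`. -/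
def VanishesTo {n d : ℕ} (m : ℕ) (A : Set (Fin n → ℂ)) (g : Coord n d → Coord n d) : Prop :=
  ∀ z ∈ A, g =O[𝓝 ((z, 0) : Coord n d)] fun p => ‖p.2‖ ^ m

/-- The maps `f(z, w) = ∑_{|Q| = l} f_Q(z) w^Q` with values in `ℂⁿ × ℂᵈ` and with coefficients
holomorphic in `z ∈ A`, that is, the maps holomorphic on `A × ℂᵈ` and homogeneous of degree `l`
in `w`. They are extended by zero off `A × ℂᵈ`, so that equality is equality over `A`. -/
noncomputable def Homog (n d l : ℕ) (A : Set (Fin n → ℂ)) : Submodule ℂ (Coord n d → Coord n d) where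
  carrier := {f | AnalyticOnNhd ℂ f (A ×ˢ Set.univ) ∧
    (∀ z ∈ A, ∀ (c : ℂ) (w : Fin d → ℂ), f (z, c • w) = c ^ l • f (z, w)) ∧
    ∀ z ∉ A, ∀ w, f (z, w) = 0}
  add_mem' := by
    rintro f g ⟨hf, hf', hf''⟩ ⟨hg, hg', hg''⟩
    refine ⟨hf.add hg, fun z hz c w => ?_, fun z hz w => ?_⟩
    · simp [hf' z hz, hg' z hz]
    · simp [hf'' z hz, hg'' z hz]
  zero_mem' := ⟨fun _ _ => analyticAt_const, by simp, by simp⟩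
  smul_mem' := by
    rintro a f ⟨hf, hf', hf''⟩
    refine ⟨fun p hp => (hf p hp).const_smul, fun z hz c w => ?_, fun z hz w => ?_⟩
    · simp only [Pi.smul_apply, hf' z hz, smul_comm a]
    · simp [hf'' z hz]

section Cover

variable {n : ℕ} {C : Type u} [TopologicalSpace C] [ChartedSpace (Fin n → ℂ) C] {ι : Type v}

namespace PolydiscCover

variable (𝒰 : PolydiscCover n C ι)

/-- `U_j` in the coordinates `z_j`. -/
def dom (j : ι) : Set (Fin n → ℂ) := (𝒰.chart j).target

/-- `U_k ∩ U_j` in the coordinates `z_j`. -/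
def overlap (k j : ι) : Set (Fin n → ℂ) :=
  {z ∈ 𝒰.dom j | (𝒰.chart j).symm z ∈ (𝒰.chart k).source}

/-- `U_k ∩ U_j ∩ U_i` in the coordinates `z_i`. -/
def triple (k j i : ι) : Set (Fin n → ℂ) := 𝒰.overlap k i ∩ 𝒰.overlap j i

/-- The transition function `φ_kj = φ_k ∘ φ_j⁻¹` of `C`. -/
noncomputable def trans (k j : ι) (z : Fin n → ℂ) : Fin n → ℂ := 𝒰.chart k ((𝒰.chart j).symm z)

end PolydiscCover

/-- A holomorphic neighborhood of `C` of codimension `d`, given by its transition functions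
`Φ_kj`: maps holomorphic near `U_kj × {0}` that extend the transition functions of `C` and
satisfy the cocycle conditions as germs. -/
structure Neighborhood (𝒰 : PolydiscCover n C ι) (d : ℕ) where
  toFun : ι → ι → Coord n d → Coord n d
  analytic : ∀ k j, AnalyticOnNhd ℂ (toFun k j) (𝒰.overlap k j ×ˢ {0})
  base : ∀ k j, ∀ z ∈ 𝒰.overlap k j, toFun k j (z, 0) = (𝒰.trans k j z, 0)
  self : ∀ j, ∀ z ∈ 𝒰.dom j, toFun j j =ᶠ[𝓝 (z, 0)] id
  cocycle : ∀ k j i, ∀ z ∈ 𝒰.triple k j i,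
    (toFun k j ∘ toFun j i) =ᶠ[𝓝 (z, 0)] toFun k i

variable {𝒰 : PolydiscCover n C ι} {d : ℕ}

/-- Cochains `{f_j}` of degree `0` with values in `T_C M ⊗ S^l N_C^*`: `f_j` is given by its
components in the frame of `T_C M` over `U_j`, as polynomials in the fibre coordinates. -/
def cochain0 (𝒰 : PolydiscCover n C ι) (d l : ℕ) : Submodule ℂ (ι → Coord n d → Coord n d) where
  carrier := {f | ∀ j, f j ∈ Homog n d l (𝒰.dom j)}
  add_mem' := fun hf hg j => add_mem (hf j) (hg j)
  zero_mem' := fun _ => zero_mem _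
  smul_mem' := fun a _ hf j => Submodule.smul_mem _ a (hf j)

/-- Cochains `{u_kj}` of degree `1` with values in `T_C M ⊗ S^l N_C^*`: `u_kj` is given by its
components in the frame of `T_C M` over `U_k`, as polynomials in the fibre coordinates `w_j`,
with coefficients depending on `z_j`. -/
def cochain1 (𝒰 : PolydiscCover n C ι) (d l : ℕ) :
    Submodule ℂ (ι → ι → Coord n d → Coord n d) where
  carrier := {u | ∀ k j, u k j ∈ Homog n d l (𝒰.overlap k j)}
  add_mem' := fun hf hg k j => add_mem (hf k j) (hg k j)
  zero_mem' := fun _ _ => zero_mem _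
  smul_mem' := fun a _ hf k j => Submodule.smul_mem _ a (hf k j)

section Cohomology

variable (N₁ : Neighborhood 𝒰 d)

/-- The transition function `g_kj` of `T_C M = TM|_C`, for `M` the neighborhood `N₁`: the
Jacobian along `C`. In blocks it is `(s_kj, l_kj; 0, t_kj)`, with `s_kj` the Jacobian of `φ_kj`. -/
noncomputable def tangentTrans (k j : ι) (z : Fin n → ℂ) : Coord n d →L[ℂ] Coord n d :=
  fderiv ℂ (N₁.toFun k j) (z, 0)

/-- The transition function `N_kj(z, w) = (φ_kj(z), t_kj(z) w)` of the normal bundle `N_C`. -/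
noncomputable def normalTrans (k j : ι) (p : Coord n d) : Coord n d :=
  (𝒰.trans k j p.1, (tangentTrans N₁ k j p.1 (0, p.2)).2)

/-- The coboundary `(δ f)_kj = g_kj f_j - f_k ∘ N_kj` of a `0`-cochain, evaluated over `U_kj`. -/
noncomputable def delta (f : ι → Coord n d → Coord n d) (k j : ι) (p : Coord n d) : Coord n d :=
  tangentTrans N₁ k j p.1 (f j p) - f k (normalTrans N₁ k j p)

theorem delta_add (f g : ι → Coord n d → Coord n d) (k j : ι) (p : Coord n d) :
    delta N₁ (f + g) k j p = delta N₁ f k j p + delta N₁ g k j p := by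
  simp only [delta, Pi.add_apply, map_add]; abel

theorem delta_smul (a : ℂ) (f : ι → Coord n d → Coord n d) (k j : ι) (p : Coord n d) :
    delta N₁ (a • f) k j p = a • delta N₁ f k j p := by
  simp only [delta, Pi.smul_apply, map_smul, smul_sub]

theorem delta_zero (k j : ι) (p : Coord n d) : delta N₁ 0 k j p = 0 := by
  simp [delta]

/-- `H⁰(C, T_C M ⊗ S^l N_C^*)`. -/
noncomputable def H0 (l : ℕ) : Submodule ℂ (ι → Coord n d → Coord n d) where
  carrier := {f | f ∈ cochain0 𝒰 d l ∧
    ∀ k j, ∀ z ∈ 𝒰.overlap k j, ∀ w, delta N₁ f k j (z, w) = 0}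
  add_mem' := by
    rintro f g ⟨hf, hf'⟩ ⟨hg, hg'⟩
    refine ⟨add_mem hf hg, fun k j z hz w => ?_⟩
    rw [delta_add, hf' k j z hz w, hg' k j z hz w, add_zero]
  zero_mem' := ⟨zero_mem _, fun k j z _ w => delta_zero N₁ k j (z, w)⟩
  smul_mem' := by
    rintro a f ⟨hf, hf'⟩
    refine ⟨Submodule.smul_mem _ a hf, fun k j z hz w => ?_⟩
    rw [delta_smul, hf' k j z hz w, smul_zero]

/-- The `1`-cocycles with values in `T_C M ⊗ S^l N_C^*`. -/
noncomputable def Z1 (l : ℕ) : Submodule ℂ (ι → ι → Coord n d → Coord n d) where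
  carrier := {u | u ∈ cochain1 𝒰 d l ∧ ∀ k j i, ∀ z ∈ 𝒰.triple k j i, ∀ w,
    u k i (z, w) = tangentTrans N₁ k j (𝒰.trans j i z) (u j i (z, w)) +
      u k j (normalTrans N₁ j i (z, w))}
  add_mem' := by
    rintro u u' ⟨hu, h⟩ ⟨hu', h'⟩
    refine ⟨add_mem hu hu', fun k j i z hz w => ?_⟩
    simp only [Pi.add_apply, h k j i z hz w, h' k j i z hz w, map_add]
    abel
  zero_mem' := ⟨zero_mem _, by intros; simp⟩
  smul_mem' := by
    rintro a u ⟨hu, h⟩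
    refine ⟨Submodule.smul_mem _ a hu, fun k j i z hz w => ?_⟩
    simp only [Pi.smul_apply, h k j i z hz w, map_smul, smul_add]

/-- The `1`-coboundaries with values in `T_C M ⊗ S^l N_C^*`. -/
noncomputable def B1 (l : ℕ) : Submodule ℂ (ι → ι → Coord n d → Coord n d) where
  carrier := {u | u ∈ cochain1 𝒰 d l ∧ ∃ f ∈ cochain0 𝒰 d l,
    ∀ k j, ∀ z ∈ 𝒰.overlap k j, ∀ w, u k j (z, w) = delta N₁ f k j (z, w)}
  add_mem' := by
    rintro u u' ⟨hu, f, hf, h⟩ ⟨hu', g, hg, h'⟩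
    refine ⟨add_mem hu hu', f + g, add_mem hf hg, fun k j z hz w => ?_⟩
    rw [delta_add, ← h k j z hz w, ← h' k j z hz w]; rfl
  zero_mem' := ⟨zero_mem _, 0, zero_mem _, fun k j z _ w => by rw [delta_zero]; rfl⟩
  smul_mem' := by
    rintro a u ⟨hu, f, hf, h⟩
    refine ⟨Submodule.smul_mem _ a hu, a • f, Submodule.smul_mem _ a hf, fun k j z hz w => ?_⟩
    rw [delta_smul, ← h k j z hz w]; rfl

/-- `H¹(C, T_C M ⊗ S^l N_C^*)`, computed on the Leray covering: cocycles modulo coboundaries. -/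
def H1 (l : ℕ) : Type v := Z1 N₁ l ⧸ (B1 N₁ l).submoduleOf (Z1 N₁ l)

noncomputable instance (l : ℕ) : AddCommGroup (H1 N₁ l) :=
  inferInstanceAs (AddCommGroup (Z1 N₁ l ⧸ (B1 N₁ l).submoduleOf (Z1 N₁ l)))

noncomputable instance (l : ℕ) : Module ℂ (H1 N₁ l) :=
  inferInstanceAs (Module ℂ (Z1 N₁ l ⧸ (B1 N₁ l).submoduleOf (Z1 N₁ l)))

/-- The cohomology class of a cocycle. -/
noncomputable def H1.mk (l : ℕ) : Z1 N₁ l →ₗ[ℂ] H1 N₁ l :=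
  ((B1 N₁ l).submoduleOf (Z1 N₁ l)).mkQ

/-- `𝓗⁰(T_C M) = ⨁_{l ≥ 2} H⁰(C, T_C M ⊗ S^l N_C^*)`. -/
abbrev CalH0 : Type v := ⨁ l : {l : ℕ // 2 ≤ l}, H0 N₁ l.1

/-- `𝓗¹(T_C M) = ⨁_{l ≥ 2} H¹(C, T_C M ⊗ S^l N_C^*)`. -/
abbrev CalH1 : Type v := ⨁ l : {l : ℕ // 2 ≤ l}, H1 N₁ l.1

/-- The completed sum `∏_{l ≥ 2} H¹(C, T_C M ⊗ S^l N_C^*)` of sequences `(c², c³, …)`. -/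
abbrev CalH1Hat : Type v := ∀ l : {l : ℕ // 2 ≤ l}, H1 N₁ l.1

/-- A basis of each `H¹(C, T_C M ⊗ S^l N_C^*)` with cocycles representing its elements. -/
structure CocycleBasis where
  idx : ℕ → Type w
  basis : ∀ l, Module.Basis (idx l) ℂ (H1 N₁ l)
  e : ∀ l, idx l → Z1 N₁ l
  mk_e : ∀ l i, H1.mk N₁ l (e l i) = basis l i

variable {N₁}

/-- The cocycle `c · e = ∑ c_i e_i`, for the class `c = ∑ c_i [e_i]`. -/
noncomputable def CocycleBasis.dot (B : CocycleBasis.{u, v, w} N₁) (l : ℕ) :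
    H1 N₁ l →ₗ[ℂ] Z1 N₁ l :=
  (B.basis l).constr ℂ (B.e l)

end Cohomology

/-- The set `𝓜` of neighborhoods `Φ = N₁ + O(2)`. -/
def Moduli (N₁ : Neighborhood 𝒰 d) : Type v :=
  {Φ : Neighborhood 𝒰 d //
    ∀ k j, VanishesTo 2 (𝒰.overlap k j) fun p => Φ.toFun k j p - N₁.toFun k j p}

/-- A formal mapping `F_j = I + ∑_{l ≥ 2} f_j^l` tangent to the identity along `C`: a formal
power series in `w` with coefficients holomorphic on `U_j`, listed by homogeneous terms. -/
structure FormalMap (𝒰 : PolydiscCover n C ι) (d : ℕ) where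
  term : ℕ → ι → Coord n d → Coord n d
  term_mem : ∀ l, term l ∈ cochain0 𝒰 d l
  term_zero : term 0 = 0
  term_one : term 1 = 0

/-- The terms of degree `≤ m` of a formal mapping. -/
def FormalMap.trunc (F : FormalMap 𝒰 d) (m : ℕ) (j : ι) (p : Coord n d) : Coord n d :=
  p + ∑ l ∈ Finset.range (m + 1), F.term l j p

/-- Formal transition functions: for each `(k, j)` a formal power series in `w_j` with
coefficients holomorphic on `U_kj`, listed by homogeneous terms. -/
structure FormalTransition (𝒰 : PolydiscCover n C ι) (d : ℕ) where
  term : ℕ → ι → ι → Coord n d → Coord n d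
  term_mem : ∀ l, term l ∈ cochain1 𝒰 d l

/-- The terms of degree `≤ m` of formal transition functions. -/
def FormalTransition.trunc (P : FormalTransition 𝒰 d) (m : ℕ) (k j : ι) (p : Coord n d) :
    Coord n d :=
  ∑ l ∈ Finset.range (m + 1), P.term l k j p

/-- `F Φ F⁻¹ = Ψ + O(m + 1)`, written as `F Φ = Ψ F + O(m + 1)`; only the terms of degree
`≤ m` of `F` matter. -/
def ConjMod (m : ℕ) (F : FormalMap 𝒰 d) (Φ Ψ : ι → ι → Coord n d → Coord n d) : Prop :=
  ∀ k j, VanishesTo (m + 1) (𝒰.overlap k j)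
    fun p => F.trunc m k (Φ k j p) - Ψ k j (F.trunc m j p)

section NormalForm

variable {N₁ : Neighborhood 𝒰 d}

/-- The base neighborhood `N₁` as an element of `𝓜`. -/
def Moduli.base (N₁ : Neighborhood 𝒰 d) : Moduli N₁ :=
  ⟨N₁, fun k j z _ => by
    simp only [sub_self]; exact isBigO_zero _ _⟩

/-- Formal equivalence in `𝓜`: there is a formal mapping `F`, tangent to the identity along
`C`, with `F Φ F⁻¹ = Ψ` in all degrees. -/
def FormalEquiv (N₁ : Neighborhood 𝒰 d) (Φ Ψ : Moduli N₁) : Prop :=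
  ∃ F : FormalMap 𝒰 d, ∀ m, ConjMod m F Φ.1.toFun Ψ.1.toFun

/-- `F` transforms `Φ` into the formal transition functions `P`: `F Φ F⁻¹ = P` in all degrees. -/
def Transforms (F : FormalMap 𝒰 d) (Φ : Moduli N₁) (P : FormalTransition 𝒰 d) : Prop :=
  ∀ m, ConjMod m F Φ.1.toFun (P.trunc m)

/-- The approximate automorphism group `Aut_m(Φ) = {F = I + O(2) : F Φ F⁻¹ = Φ + O(m + 1)}`. -/
def AutMod (m : ℕ) (Φ : Moduli N₁) : Set (FormalMap 𝒰 d) :=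
  {F | ConjMod m F Φ.1.toFun Φ.1.toFun}

/-- `Ψ = Φ + c · e^m + O(m + 1)`. -/
def IsShift (B : CocycleBasis.{u, v, w} N₁) (m : ℕ) (Φ Ψ : Moduli N₁) (c : H1 N₁ m) : Prop :=
  ∀ k j, VanishesTo (m + 1) (𝒰.overlap k j)
    fun p => Ψ.1.toFun k j p - (Φ.1.toFun k j p + (B.dot m c).1 k j p)

/-- `𝓜_m(Φ) = {Ψ ∈ 𝓜 : Ψ = Φ + c · e^m + O(m + 1) for some c}`. -/
def ModuliMod (B : CocycleBasis.{u, v, w} N₁) (m : ℕ) (Φ : Moduli N₁) : Set (Moduli N₁) :=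
  {Ψ | ∃ c, IsShift B m Φ Ψ c}

/-- The relation on `𝓜_m(Φ)` given by conjugacy, modulo terms of degree `> m`, by mappings that
preserve `Φ` modulo terms of degree `≥ m`: `F Ψ F⁻¹ = Ψ' + O(m + 1)` for an
`F ∈ Aut_{m-1}(Φ)`. -/
def AutRel (m : ℕ) (Φ Ψ Ψ' : Moduli N₁) : Prop :=
  ∃ F ∈ AutMod (m - 1) Φ, ConjMod m F Ψ.1.toFun Ψ'.1.toFun

/-- A choice, for all `Φ ∈ 𝓜` and `m ≥ 2`, of a set `𝓝_m(Φ)` containing exactly one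
representative of each equivalence class in `𝓜_m(Φ)`, with `Φ` representing its own class. -/
structure Representatives (B : CocycleBasis.{u, v, w} N₁) where
  reps : ℕ → Moduli N₁ → Set (Moduli N₁)
  reps_subset : ∀ m, 2 ≤ m → ∀ Φ, reps m Φ ⊆ ModuliMod B m Φ
  existsUnique : ∀ m, 2 ≤ m → ∀ Φ, ∀ Ψ ∈ ModuliMod B m Φ,
    ∃! Ψ', Ψ' ∈ reps m Φ ∧ AutRel m Φ Ψ Ψ'
  self_mem : ∀ m, 2 ≤ m → ∀ Φ, Φ ∈ reps m Φ

variable {B : CocycleBasis.{u, v, w} N₁}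

/-- `N^m = N^m(c², …, c^m)` for all `m ≥ 1`: the sequence of partial normal forms determined by
`c`. It starts at `N^1 = N₁`, and `N^(m+1) = N^m + c^(m+1) · e^(m+1) + O(m + 2)` is one of the
chosen representatives in `𝓜_{m+1}(N^m)`. -/
def IsPartialNormalForms (R : Representatives B) (c : CalH1Hat N₁) (N : ℕ → Moduli N₁) : Prop :=
  N 1 = Moduli.base N₁ ∧ ∀ (m : ℕ) (hm : 1 ≤ m),
    N (m + 1) ∈ R.reps (m + 1) (N m) ∧
    IsShift B (m + 1) (N m) (N (m + 1)) (c ⟨m + 1, Nat.succ_le_succ hm⟩)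

/-- `P = N^∞(c², c³, …)`: the formal transition functions with `P = N^m(c², …, c^m) + O(m + 1)`
for all `m`. -/
def IsLimit (P : FormalTransition 𝒰 d) (N : ℕ → Moduli N₁) : Prop :=
  ∀ m, 1 ≤ m → ∀ k j, VanishesTo (m + 1) (𝒰.overlap k j)
    fun p => P.trunc m k j p - (N m).1.toFun k j p

/-- The set `𝓝_∞` of all formal normal forms `N^∞(c², c³, …)`. -/
def NormalForms (R : Representatives B) : Set (FormalTransition 𝒰 d) :=
  {P | ∃ c N, IsPartialNormalForms R c N ∧ IsLimit P N}

/-- `P = N^∞(c², c³, …)` is a formal normal form of `Φ`: for every `m` there is an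
`F = I + O(2)` with `F Φ F⁻¹ = N^m(c², …, c^m) + O(m + 1)`. -/
def IsNormalFormOf (R : Representatives B) (Φ : Moduli N₁) (c : CalH1Hat N₁)
    (P : FormalTransition 𝒰 d) : Prop :=
  ∃ N, IsPartialNormalForms R c N ∧ IsLimit P N ∧
    ∀ m, 1 ≤ m → ∃ F : FormalMap 𝒰 d, ConjMod m F Φ.1.toFun (N m).1.toFun

end NormalForm

end Cover

end FormalNbhd

/-!
The classification rests on a degree by degree analysis of the conjugacy equation `F Φ = Ψ F`.
If germs `G_j = I + O(2)` satisfy `G Φ = Ψ G + O(m + 1)`, then the terms of degree `m + 1` of the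
defect `G Φ - Ψ G` form a cocycle with values in `T_C M ⊗ S^(m+1) N_C^*`, and adding a homogeneous
term `f` to `G` subtracts the coboundary `δ f` from it (`exists_cocycle_of_germConj`,
`IsTangent.ordAt_defect_add`). The first statement uses that the exact conjugate `G Φ G⁻¹` is again
an element of `𝓜` (`Moduli.exists_conj`), so that two exact cocycle conditions can be compared.
Hence conjugacy modulo `O(m + 1)` can be continued by one degree after adding a chosen cocycle
`c · e^(m+1)` to `Ψ` (`exists_moduliMod_equivMod`).

Conjugacy modulo `O(m + 1)` (`EquivMod`) is an equivalence relation on `𝓜`, and on `𝓜_m(Φ)` it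
coincides with the relation defined by `Aut_{m-1}(Φ)`, because the elements of `𝓜_m(Φ)` agree with
`Φ` modulo `O(m)` (`autRel_iff`). So representatives exist, and the partial normal form
`N^(m+1)` is the unique chosen representative in `𝓜_{m+1}(N^m)` conjugate to `Φ` modulo `O(m + 2)`.
It is also determined by its class, since representatives with the same class agree modulo
`O(m + 2)`. This gives existence and uniqueness of `c(Φ)` and of `N^∞(Φ)`, and shows that both only
depend on `Φ` up to conjugacy modulo every `O(m + 1)`.

Injectivity requires one formal mapping that works for all `m`. If `𝓗⁰ = 0`, a conjugacy modulo
`O(m + 1)` is unique up to degree `m`, so the conjugacies fit together (`exists_conjMod_of_H0`). If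
`𝓗¹` is finite-dimensional, the spaces `H¹` vanish in large degrees, and a conjugacy of
sufficiently high order extends without changing its lower terms (`exists_conjMod_of_H1`).

Everything is done with honest germs along `U_j × {0}`: the truncations of formal mappings are
germs, composition and inversion are those of germs, and a coherent sequence of germs has a formal
limit (`FormalMap.exists_of_seq`), whose terms are the homogeneous parts of the Taylor expansion
in `w` (`homogPart`). The uniform remainder estimate for this expansion
(`ordAt_sub_sum_homogPart`) comes from the Cauchy estimates on complex lines in the fibres.
-/

/-! ### Orders of vanishing along the zero section -/

namespace FormalNbhd

/-- `g = O(|w|^m)` near the single point `(z, 0)` of the zero section: the pointwise form of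
`VanishesTo`, for maps with values in any normed space. -/
abbrev OrdAt {n d : ℕ} {E : Type*} [Norm E] (m : ℕ) (z : Fin n → ℂ) (g : Coord n d → E) : Prop :=
  g =O[𝓝 ((z, 0) : Coord n d)] fun p => ‖p.2‖ ^ m

section Order

variable {n d : ℕ} {E F : Type*} [NormedAddCommGroup E] [NormedAddCommGroup F] {l m : ℕ}
  {z y : Fin n → ℂ} {g h : Coord n d → E}

theorem eventually_norm_snd_lt (z : Fin n → ℂ) {ε : ℝ} (hε : 0 < ε) :
    ∀ᶠ p in 𝓝 ((z, 0) : Coord n d), ‖p.2‖ < ε := by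
  have : Filter.Tendsto (fun p : Coord n d => ‖p.2‖) (𝓝 (z, 0)) (𝓝 0) := by
    have h : ContinuousAt (fun p : Coord n d => ‖p.2‖) (z, 0) := by fun_prop
    simpa [ContinuousAt] using h
  exact this.eventually_lt_const hε

theorem OrdAt.mono (h : OrdAt m z g) (hl : l ≤ m) : OrdAt l z g := by
  refine h.trans (IsBigO.of_bound 1 ?_)
  filter_upwards [eventually_norm_snd_lt (d := d) z one_pos] with p hp
  rw [one_mul, Real.norm_of_nonneg (by positivity), Real.norm_of_nonneg (by positivity)]
  exact pow_le_pow_of_le_one (norm_nonneg _) hp.le hl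

theorem OrdAt.apply_eq_zero (h : OrdAt m z g) (hm : m ≠ 0) : g (z, 0) = 0 := by
  obtain ⟨c, hc⟩ := h.bound
  have := hc.self_of_nhds
  simpa [hm] using this

theorem OrdAt.tendsto_zero (h : OrdAt m z g) (hm : m ≠ 0) :
    Filter.Tendsto g (𝓝 (z, 0)) (𝓝 0) := by
  refine h.trans_tendsto ?_
  have : ContinuousAt (fun p : Coord n d => ‖p.2‖ ^ m) (z, 0) := by fun_prop
  simpa [ContinuousAt, hm] using this

theorem ordAt_of_eventuallyEq_zero (h : g =ᶠ[𝓝 (z, 0)] 0) : OrdAt m z g :=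
  h.trans_isBigO (isBigO_zero _ _)

theorem ordAt_one_snd : OrdAt 1 z fun p : Coord n d => p.2 := by
  simpa [OrdAt] using (isBigO_refl (fun p : Coord n d => p.2) (𝓝 (z, 0))).norm_right

/-- A map carrying the germ of the zero section at `(z, 0)` to the zero section at `(y, 0)`, in the
quantitative form that its normal component is `O(|w|)`. -/
structure AdaptedAt (K : Coord n d → Coord n d) (z y : Fin n → ℂ) : Prop where
  tendsto : Filter.Tendsto K (𝓝 (z, 0)) (𝓝 (y, 0))
  normal : OrdAt 1 z fun p => (K p).2

theorem adaptedAt_id (z : Fin n → ℂ) : AdaptedAt (fun p : Coord n d => p) z z :=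
  ⟨Filter.tendsto_id, ordAt_one_snd⟩

theorem OrdAt.comp {K : Coord n d → Coord n d} (h : OrdAt m y g) (hK : AdaptedAt K z y) :
    OrdAt m z fun p => g (K p) := by
  refine (IsBigO.comp_tendsto h hK.tendsto).trans ?_
  have := hK.normal.norm_left.pow m
  simpa [Function.comp_def] using this

theorem AdaptedAt.comp {K L : Coord n d → Coord n d} {x : Fin n → ℂ} (hK : AdaptedAt K y x)
    (hL : AdaptedAt L z y) : AdaptedAt (fun p => K (L p)) z x :=
  ⟨hK.tendsto.comp hL.tendsto, OrdAt.comp (g := fun p => (K p).2) hK.normal hL⟩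

theorem OrdAt.fst {g : Coord n d → Coord n d} (h : OrdAt m z g) : OrdAt m z fun p => (g p).1 :=
  isBigO_fst_prod'.trans h

theorem OrdAt.snd {g : Coord n d → Coord n d} (h : OrdAt m z g) : OrdAt m z fun p => (g p).2 :=
  isBigO_snd_prod'.trans h

/-- Adaptedness only depends on a map modulo terms vanishing along the zero section. -/
theorem AdaptedAt.of_ordAt_sub {K L : Coord n d → Coord n d} (hK : AdaptedAt K z y)
    (h : OrdAt 1 z fun p => K p - L p) : AdaptedAt L z y := by
  constructor
  · simpa using hK.tendsto.sub (OrdAt.tendsto_zero h one_ne_zero)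
  · simpa using hK.normal.sub (OrdAt.snd h)

variable [NormedSpace ℂ F]

/-- Composition with a differentiable map on the left preserves congruence modulo `O(m)`. -/
theorem OrdAt.comp_sub_comp {K : Coord n d → F} {A B : Coord n d → Coord n d}
    (hK : AnalyticAt ℂ K (y, 0)) (hA : Filter.Tendsto A (𝓝 (z, 0)) (𝓝 (y, 0)))
    (hB : Filter.Tendsto B (𝓝 (z, 0)) (𝓝 (y, 0))) (h : OrdAt m z fun p => A p - B p) :
    OrdAt m z fun p => K (A p) - K (B p) := by
  have := hK.hasStrictFDerivAt.isBigO_sub.comp_tendsto (hA.prodMk_nhds hB)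
  exact this.trans h

/-- First order Taylor expansion with the derivative taken at a third nearby point. -/
theorem exists_norm_sub_sub_fderiv_le {X : Type*} [NormedAddCommGroup X] [NormedSpace ℂ X]
    [CompleteSpace F] {K : X → F} {x : X} (hK : AnalyticAt ℂ K x) :
    ∃ C : ℝ, 0 ≤ C ∧ ∃ ε > 0, ∀ a ∈ Metric.ball x ε, ∀ b ∈ Metric.ball x ε,
      ∀ c ∈ Metric.ball x ε,
      ‖K a - K b - fderiv ℂ K c (a - b)‖ ≤ C * (‖a - c‖ + ‖b - c‖) * ‖a - b‖ := by
  obtain ⟨C, s, hs, hC⟩ := hK.fderiv.hasStrictFDerivAt.exists_lipschitzOnWith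
  obtain ⟨ε, hε, hball⟩ := Metric.eventually_nhds_iff_ball.1
    (hK.eventually_analyticAt.and (Filter.eventually_mem_set.2 hs))
  let _ : NormedSpace ℝ X := NormedSpace.restrictScalars ℝ ℂ X
  refine ⟨C, C.2, ε, hε, fun a ha b hb c hc => ?_⟩
  set T := Metric.ball x ε ∩ Metric.closedBall c (‖a - c‖ + ‖b - c‖)
  have hT : Convex ℝ T := (convex_ball _ _).inter (convex_closedBall _ _)
  have haT : a ∈ T := ⟨ha, by simp [dist_eq_norm]⟩
  have hbT : b ∈ T := ⟨hb, by simp [dist_eq_norm]⟩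
  refine hT.norm_image_sub_le_of_norm_hasFDerivWithin_le' (f' := fderiv ℂ K)
    (fun q hq => (hball q hq.1).1.differentiableAt.hasFDerivAt.hasFDerivWithinAt)
    (fun q hq => ?_) hbT haT
  have h1 := hC.dist_le_mul q (hball q hq.1).2 c (hball c hc).2
  rw [dist_eq_norm] at h1
  exact h1.trans (mul_le_mul_of_nonneg_left hq.2 C.2)

/-- If `A - B = O(l)` and `A`, `B` agree with `b` on the zero section, then
`K ∘ A - K ∘ B` is `DK(b) (A - B)` modulo `O(l + 1)`. -/
theorem OrdAt.comp_sub_comp_sub_fderiv [CompleteSpace F] {K : Coord n d → F}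
    {A B b : Coord n d → Coord n d}
    (hK : AnalyticAt ℂ K (y, 0)) (hb : Filter.Tendsto b (𝓝 (z, 0)) (𝓝 (y, 0)))
    (hAb : OrdAt 1 z fun p => A p - b p) (hBb : OrdAt 1 z fun p => B p - b p)
    (h : OrdAt l z fun p => A p - B p) :
    OrdAt (l + 1) z fun p => K (A p) - K (B p) - fderiv ℂ K (b p) (A p - B p) := by
  obtain ⟨C, hC, ε, hε, hK'⟩ := exists_norm_sub_sub_fderiv_le hK
  have hA : Filter.Tendsto A (𝓝 (z, 0)) (𝓝 (y, 0)) := by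
    simpa using (OrdAt.tendsto_zero hAb one_ne_zero).add hb
  have hB : Filter.Tendsto B (𝓝 (z, 0)) (𝓝 (y, 0)) := by
    simpa using (OrdAt.tendsto_zero hBb one_ne_zero).add hb
  have h1 : (fun p => K (A p) - K (B p) - fderiv ℂ K (b p) (A p - B p)) =O[𝓝 (z, 0)]
      fun p => (‖A p - b p‖ + ‖B p - b p‖) * ‖A p - B p‖ := by
    refine IsBigO.of_bound C ?_
    filter_upwards [hA (Metric.ball_mem_nhds _ hε), hB (Metric.ball_mem_nhds _ hε),
      hb (Metric.ball_mem_nhds _ hε)] with p h1 h2 h3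
    rw [Real.norm_of_nonneg (by positivity), ← mul_assoc]
    exact hK' _ h1 _ h2 _ h3
  refine h1.trans ?_
  have := (hAb.norm_left.add hBb.norm_left).mul h.norm_left
  simpa [OrdAt, pow_succ', pow_one] using this

/-- A map that is `O(2)` has vanishing derivative along the zero section. -/
theorem OrdAt.hasFDerivAt_zero {g : Coord n d → F} (h : OrdAt 2 z g) :
    HasFDerivAt g (0 : Coord n d →L[ℂ] F) (z, 0) := by
  refine IsBigO.hasFDerivAt (n := 2) (h.trans (IsBigO.of_bound 1 ?_)) one_lt_two
  filter_upwards with p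
  rw [one_mul, Real.norm_of_nonneg (by positivity), Real.norm_of_nonneg (by positivity)]
  have : ‖p.2‖ ≤ ‖p - (z, 0)‖ := by
    have := norm_snd_le (p - (z, 0))
    rwa [Prod.snd_sub, sub_zero] at this
  gcongr

/-- A holomorphic map vanishing on the zero section is `O(1)`. -/
theorem ordAt_one_of_analyticAt {K : Coord n d → F} (hK : AnalyticAt ℂ K (z, 0))
    (h0 : ∀ᶠ x in 𝓝 z, K (x, 0) = 0) : OrdAt 1 z K := by
  have hb : Filter.Tendsto (fun p : Coord n d => (p.1, (0 : Fin d → ℂ))) (𝓝 (z, 0)) (𝓝 (z, 0)) := by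
    have : ContinuousAt (fun p : Coord n d => (p.1, (0 : Fin d → ℂ))) (z, 0) := by fun_prop
    simpa [ContinuousAt] using this
  have hs : OrdAt 1 z fun p : Coord n d => p - (p.1, 0) :=
    (IsBigO.of_bound 1 (.of_forall fun p => by simp [Prod.norm_def]))
  have h1 := OrdAt.comp_sub_comp hK (Filter.tendsto_id (x := 𝓝 (z, 0))) hb hs
  refine h1.congr' ?_ .rfl
  have : Filter.Tendsto (fun p : Coord n d => p.1) (𝓝 (z, 0)) (𝓝 z) :=
    (continuous_fst.tendsto _)
  filter_upwards [this.eventually h0] with p hp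
  simp [hp]

end Order

section Homogeneous

variable {n d : ℕ} {F : Type*} [NormedAddCommGroup F] [NormedSpace ℂ F] {l m : ℕ}
  {z y : Fin n → ℂ}

/-- A map homogeneous of degree `l` in `w` that is `O(l + 1)` vanishes on the fibre. -/
theorem OrdAt.eq_zero_of_homogeneous {u : Coord n d → F}
    (hu : ∀ (c : ℂ) w, u (z, c • w) = c ^ l • u (z, w)) (h : OrdAt (l + 1) z u)
    (w : Fin d → ℂ) : u (z, w) = 0 := by
  obtain ⟨C, hC⟩ := h.bound
  have hcont : Filter.Tendsto (fun t : ℂ => ((z, t • w) : Coord n d)) (𝓝[≠] 0) (𝓝 (z, 0)) := by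
    have : ContinuousAt (fun t : ℂ => ((z, t • w) : Coord n d)) 0 := by fun_prop
    simpa [ContinuousAt] using this.tendsto.mono_left nhdsWithin_le_nhds
  have hlim : Filter.Tendsto (fun t : ℂ => ‖t‖ * (C * ‖w‖ ^ (l + 1))) (𝓝[≠] 0) (𝓝 0) := by
    have : ContinuousAt (fun t : ℂ => ‖t‖ * (C * ‖w‖ ^ (l + 1))) 0 := by fun_prop
    simpa [ContinuousAt] using this.tendsto.mono_left nhdsWithin_le_nhds
  have hle : ‖u (z, w)‖ ≤ 0 := by
    refine ge_of_tendsto hlim ?_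
    filter_upwards [hcont.eventually hC, self_mem_nhdsWithin] with t ht ht0
    rw [hu, norm_smul, norm_pow, norm_pow, norm_norm, norm_smul] at ht
    have h0 : 0 < ‖t‖ := norm_pos_iff.2 ht0
    refine le_of_mul_le_mul_left (ht.trans (le_of_eq ?_)) (pow_pos h0 l)
    ring
  simpa using hle

/-- A homogeneous term has the order given by its degree. -/
theorem ordAt_of_homogeneous {u : Coord n d → F} (hc : ContinuousAt u (z, 0))
    (hu : ∀ᶠ x in 𝓝 z, ∀ (c : ℂ) w, u (x, c • w) = c ^ l • u (x, w)) : OrdAt l z u := by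
  have hb : ∀ᶠ p in 𝓝 ((z, 0) : Coord n d), ‖u p‖ < ‖u (z, 0)‖ + 1 :=
    hc.norm.eventually_lt_const (lt_add_one _)
  obtain ⟨ε, hε, hball⟩ := Metric.eventually_nhds_iff_ball.1 hb
  set M := ‖u (z, 0)‖ + 1
  have hfst : Filter.Tendsto (fun p : Coord n d => p.1) (𝓝 (z, 0)) (𝓝 z) :=
    (continuous_fst.tendsto _)
  refine IsBigO.of_bound (M * (2 / ε) ^ l) ?_
  filter_upwards [hfst.eventually hu, Metric.ball_mem_nhds _ hε] with p hp hpb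
  obtain ⟨x, w⟩ := p
  rw [Real.norm_of_nonneg (by positivity)]
  -- the fibre is rescaled to the radius `ε / 2`, where `u` is bounded
  set t : ℝ := ‖w‖ * (2 / ε) with ht
  have ht0 : 0 ≤ t := by positivity
  by_cases hw : w = 0
  · subst hw
    by_cases hl : l = 0
    · subst hl
      simpa using (hball _ hpb).le
    · have := hp 0 0
      simp [hl] at this
      simp [this, hl]
  · have hwp : 0 < ‖w‖ := norm_pos_iff.2 hw
    have htp : 0 < t := by positivity
    have hxw : (x, ((t : ℂ)⁻¹ • w)) ∈ Metric.ball ((z, 0) : Coord n d) ε := by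
      rw [Metric.mem_ball, Prod.dist_eq, max_lt_iff] at hpb ⊢
      refine ⟨hpb.1, ?_⟩
      rw [dist_zero_right, norm_smul, norm_inv, Complex.norm_real, Real.norm_of_nonneg ht0, ht]
      field_simp
      norm_num
    have h1 : u (x, w) = (t : ℂ) ^ l • u (x, (t : ℂ)⁻¹ • w) := by
      rw [← hp, smul_inv_smul₀ (by exact_mod_cast htp.ne')]
    rw [h1, norm_smul, norm_pow, Complex.norm_real, Real.norm_of_nonneg ht0]
    calc t ^ l * ‖u (x, (t : ℂ)⁻¹ • w)‖ ≤ t ^ l * M := by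
          gcongr; exact (hball _ hxw).le
      _ = M * (2 / ε) ^ l * ‖w‖ ^ l := by rw [ht, mul_pow]; ring

/-- A homogeneous term of degree `l ≥ 1`, composed with a map `A`, only depends modulo
`O(l + 1)` on the lowest order terms of `A`. -/
theorem OrdAt.homogeneous_comp_sub_comp {u : Coord n d → F} {A B : Coord n d → Coord n d}
    (ha : AnalyticAt ℂ u (y, 0)) (hl : 1 ≤ l)
    (hu : ∀ᶠ x in 𝓝 y, ∀ (c : ℂ) w, u (x, c • w) = c ^ l • u (x, w))
    (hA : AdaptedAt A z y) (h1 : OrdAt 1 z fun p => (A p).1 - (B p).1)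
    (h2 : OrdAt 2 z fun p => (A p).2 - (B p).2) :
    OrdAt (l + 1) z fun p => u (A p) - u (B p) := by
  have hB : AdaptedAt B z y := hA.of_ordAt_sub (h1.prod_left (OrdAt.mono h2 one_le_two))
  obtain ⟨C, s, hs, hC⟩ := ha.hasStrictFDerivAt.exists_lipschitzOnWith
  obtain ⟨ε, hε, hball⟩ := Metric.mem_nhds_iff.1 hs
  -- both normal components, divided by `ρ p`, lie in the ball where `u` is Lipschitz
  have hfst : Filter.Tendsto (fun p : Coord n d => p.1) (𝓝 (y, 0)) (𝓝 y) :=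
    (continuous_fst.tendsto _)
  set ρ : Coord n d → ℝ := fun p => (‖(A p).2‖ + ‖(B p).2‖) * (2 / ε) with hρ
  have hρO : OrdAt 1 z ρ := by
    have := (hA.normal.norm_left.add hB.normal.norm_left).const_mul_left (2 / ε)
    exact this.congr_left fun p => mul_comm _ _
  have hρn : ∀ p, 0 ≤ ρ p := fun p => by positivity
  have key : (fun p => u (A p) - u (B p)) =O[𝓝 (z, 0)]
      fun p => ρ p ^ l * ‖(A p).1 - (B p).1‖ + ρ p ^ (l - 1) * ‖(A p).2 - (B p).2‖ := by
    refine IsBigO.of_bound C ?_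
    filter_upwards [(hfst.comp hA.tendsto).eventually hu, (hfst.comp hB.tendsto).eventually hu,
      hA.tendsto (Metric.ball_mem_nhds _ hε), hB.tendsto (Metric.ball_mem_nhds _ hε)]
      with p hpA hpB hA' hB'
    have hp0 := hρn p
    rw [Real.norm_of_nonneg (by positivity)]
    simp only [Function.comp] at hpA hpB
    generalize hr : ρ p = r at *
    rw [hρ] at hr
    simp only [mem_preimage] at hA' hB'
    simp only at hr
    generalize A p = P at hpA hpB hA' hB' hr ⊢
    generalize B p = Q at hpA hpB hA' hB' hr ⊢
    obtain ⟨a, w⟩ := P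
    obtain ⟨a', w'⟩ := Q
    simp only at hpA hpB hr ⊢
    rcases hp0.eq_or_lt with h0 | h0
    · have : ‖w‖ + ‖w'‖ = 0 := by
        have h2 : (2 / ε) ≠ 0 := by positivity
        rw [← h0] at hr
        exact (mul_eq_zero.1 hr).resolve_right h2
      have hw : w = 0 := norm_eq_zero.1 (by linarith [norm_nonneg w, norm_nonneg w'])
      have hw' : w' = 0 := norm_eq_zero.1 (by linarith [norm_nonneg w, norm_nonneg w'])
      subst hw; subst hw'
      have e1 := hpA 0 0
      have e2 := hpB 0 0
      have hl0 : l ≠ 0 := by omega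
      simp only [smul_zero, zero_pow hl0, zero_smul] at e1 e2
      rw [e1, e2, sub_zero, norm_zero]
      positivity
    · have hrc : (r : ℂ) ≠ 0 := by exact_mod_cast h0.ne'
      have hmem : ∀ (x : Fin n → ℂ) (v : Fin d → ℂ), (x, v) ∈ Metric.ball ((y, 0) : Coord n d) ε →
          ‖v‖ ≤ ‖w‖ + ‖w'‖ → (x, (r : ℂ)⁻¹ • v) ∈ s := by
        intro x v hx hv
        apply hball
        rw [Metric.mem_ball, Prod.dist_eq, max_lt_iff] at hx ⊢
        refine ⟨hx.1, ?_⟩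
        rw [dist_zero_right, norm_smul, norm_inv, Complex.norm_real, Real.norm_of_nonneg hp0,
          inv_mul_lt_iff₀ h0, ← hr]
        have : 0 < ‖w‖ + ‖w'‖ := by
          by_contra hcon
          have : (‖w‖ + ‖w'‖) * (2 / ε) ≤ 0 :=
            mul_nonpos_of_nonpos_of_nonneg (not_lt.1 hcon) (by positivity)
          linarith
        have h3 : (‖w‖ + ‖w'‖) * (2 / ε) * ε = 2 * (‖w‖ + ‖w'‖) := by field_simp
        linarith
      have h1 : u (a, w) = (r : ℂ) ^ l • u (a, (r : ℂ)⁻¹ • w) := by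
        rw [← hpA, smul_inv_smul₀ hrc]
      have h2 : u (a', w') = (r : ℂ) ^ l • u (a', (r : ℂ)⁻¹ • w') := by
        rw [← hpB, smul_inv_smul₀ hrc]
      have hL := hC.dist_le_mul _ (hmem a w hA' (by linarith [norm_nonneg w']))
        _ (hmem a' w' hB' (by linarith [norm_nonneg w]))
      rw [dist_eq_norm, Prod.dist_eq, dist_eq_norm, dist_eq_norm, ← smul_sub, norm_smul, norm_inv,
        Complex.norm_real, Real.norm_of_nonneg hp0] at hL
      rw [h1, h2, ← smul_sub, norm_smul, norm_pow, Complex.norm_real, Real.norm_of_nonneg hp0]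
      obtain ⟨k, rfl⟩ : ∃ k, l = k + 1 := ⟨l - 1, by omega⟩
      have hmax : max ‖a - a'‖ (r⁻¹ * ‖w - w'‖) ≤ ‖a - a'‖ + r⁻¹ * ‖w - w'‖ :=
        max_le_add_of_nonneg (norm_nonneg _) (by positivity)
      calc r ^ (k + 1) * ‖u (a, (r : ℂ)⁻¹ • w) - u (a', (r : ℂ)⁻¹ • w')‖
          ≤ r ^ (k + 1) * (C * (‖a - a'‖ + r⁻¹ * ‖w - w'‖)) := by
            gcongr; exact hL.trans (by gcongr)
        _ = C * (r ^ (k + 1) * ‖a - a'‖ + r ^ (k + 1 - 1) * ‖w - w'‖) := by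
            simp only [Nat.add_sub_cancel]
            field_simp
            ring
  refine key.trans (IsBigO.add ?_ ?_)
  · have := (IsBigO.pow hρO l).mul h1.norm_left
    simpa [OrdAt, ← pow_succ] using this
  · have := (IsBigO.pow hρO (l - 1)).mul h2.norm_left
    refine this.congr_right fun p => ?_
    rw [pow_one, ← pow_add]
    congr 1; omega

end Homogeneous

/-! ### Homogeneous parts -/

section Taylor

variable {n d : ℕ}

/-- The homogeneous part of degree `l` in `w` of the Taylor expansion of `g` along `A × {0}`,
extended by zero off `A × ℂᵈ`. -/
noncomputable def homogPart (A : Set (Fin n → ℂ)) (l : ℕ) (g : Coord n d → Coord n d) :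
    Coord n d → Coord n d :=
  open Classical in fun p => if p.1 ∈ A then
    (l.factorial : ℂ)⁻¹ • iteratedDeriv l (fun t : ℂ => g (p.1, t • p.2)) 0 else 0

theorem iteratedDeriv_comp_mul_left_apply {E : Type*} [NormedAddCommGroup E] [NormedSpace ℂ E]
    (f : ℂ → E) (c : ℂ) (l : ℕ) :
    iteratedDeriv l (fun t => f (c * t)) = fun t => c ^ l • iteratedDeriv l f (c * t) := by
  induction l with
  | zero => simp
  | succ l ih =>
    ext t
    have h : (fun t => c ^ l • iteratedDeriv l f (c * t)) =
        c ^ l • fun t => iteratedDeriv l f (c * t) := rfl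
    rw [iteratedDeriv_succ, ih, h, deriv_const_smul_field, deriv_comp_mul_left,
      iteratedDeriv_succ, smul_smul, pow_succ]

/-- Derivatives in a complex parameter of a jointly analytic function are jointly analytic. -/
theorem analyticOnNhd_iteratedDeriv {X E : Type*} [NormedAddCommGroup X] [NormedSpace ℂ X]
    [NormedAddCommGroup E] [NormedSpace ℂ E] [CompleteSpace E] {H : ℂ → X → E} {V : Set (ℂ × X)}
    (hV : AnalyticOnNhd ℂ (fun q : ℂ × X => H q.1 q.2) V) (l : ℕ) :
    AnalyticOnNhd ℂ (fun q : ℂ × X => iteratedDeriv l (fun t => H t q.2) q.1) V := by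
  induction l with
  | zero => simpa using hV
  | succ l ih =>
    intro q hq
    have h1 := (ih q hq).fderiv
    have h2 : AnalyticAt ℂ (fun q' : ℂ × X =>
        fderiv ℂ (fun q : ℂ × X => iteratedDeriv l (fun t => H t q.2) q.1) q' (1, 0)) q :=
      ((ContinuousLinearMap.apply ℂ E ((1, 0) : ℂ × X)).analyticAt _).comp h1
    refine h2.congr ?_
    filter_upwards [(ih q hq).eventually_analyticAt] with q' hq'
    rw [iteratedDeriv_succ]
    have h3 : HasDerivAt (fun t : ℂ => ((t, q'.2) : ℂ × X)) (1, 0) q'.1 :=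
      (hasDerivAt_id q'.1).prodMk (hasDerivAt_const q'.1 q'.2)
    have h4 := HasFDerivAt.comp_hasDerivAt (f := fun t : ℂ => ((t, q'.2) : ℂ × X)) q'.1
      (hq'.differentiableAt.hasFDerivAt (x := (q'.1, q'.2))) h3
    exact h4.deriv.symm

theorem homogPart_mem {A : Set (Fin n → ℂ)} (hA : IsOpen A) (l : ℕ) {g : Coord n d → Coord n d}
    (hg : AnalyticOnNhd ℂ g (A ×ˢ {0})) : homogPart A l g ∈ Homog n d l A := by
  refine ⟨?_, fun z hz c w => ?_, fun z hz w => by simp [homogPart, hz]⟩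
  · rintro ⟨z, w⟩ ⟨hz, -⟩
    have hV : AnalyticOnNhd ℂ
        (fun q : ℂ × Coord n d => (fun (t : ℂ) (p : Coord n d) => g (p.1, t • p.2)) q.1 q.2)
        {(0, (z, w))} := by
      rintro _ rfl
      refine AnalyticAt.fun_comp (g := g) (f := fun q : ℂ × Coord n d => (q.2.1, q.1 • q.2.2)) ?_ ?_
      · simpa using hg (z, 0) ⟨hz, rfl⟩
      · exact (analyticAt_fst.comp analyticAt_snd).prod
          (analyticAt_fst.smul (analyticAt_snd.comp analyticAt_snd))
    have h := analyticOnNhd_iteratedDeriv (H := fun (t : ℂ) (p : Coord n d) => g (p.1, t • p.2)) hV l _ (mem_singleton _)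
    have h1 : AnalyticAt ℂ (fun p : Coord n d =>
        iteratedDeriv l (fun t : ℂ => g (p.1, t • p.2)) 0) (z, w) :=
      AnalyticAt.fun_comp (f := fun p : Coord n d => ((0 : ℂ), p)) h
        (analyticAt_const.prod analyticAt_id)
    have h2 := (analyticAt_const (v := (l.factorial : ℂ)⁻¹)).fun_smul h1
    refine h2.congr ?_
    have hfst : Filter.Tendsto (fun p : Coord n d => p.1) (𝓝 (z, w)) (𝓝 z) :=
      (continuous_fst.tendsto _)
    have hfA : ∀ᶠ p in 𝓝 (z, w), p.1 ∈ A := hfst.eventually (hA.mem_nhds hz)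
    filter_upwards [hfA] with p hp
    simp [homogPart, hp]
  · have h := congrFun (iteratedDeriv_comp_mul_left_apply (fun t : ℂ => g (z, t • w)) c l) 0
    simp only [mul_zero] at h
    simp only [homogPart, hz, if_true]
    rw [smul_comm, ← h]
    simp [smul_smul, mul_comm]

/-- Taylor expansion along the zero section, uniformly in the base point. -/
theorem ordAt_sub_sum_homogPart {A : Set (Fin n → ℂ)} (hA : IsOpen A) {z : Fin n → ℂ} (hz : z ∈ A)
    (m : ℕ) {g : Coord n d → Coord n d} (hg : AnalyticAt ℂ g (z, 0)) :
    OrdAt (m + 1) z fun p => g p - ∑ l ∈ Finset.range (m + 1), homogPart A l g p := by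
  have hb : ∀ᶠ p in 𝓝 ((z, 0) : Coord n d), ‖g p‖ < ‖g (z, 0)‖ + 1 :=
    hg.continuousAt.norm.eventually_lt_const (lt_add_one _)
  obtain ⟨ε, hε, hball⟩ := Metric.eventually_nhds_iff_ball.1 (hb.and hg.eventually_analyticAt)
  set M := ‖g (z, 0)‖ + 1
  have hfst : Filter.Tendsto (fun p : Coord n d => p.1) (𝓝 (z, 0)) (𝓝 z) :=
    (continuous_fst.tendsto _)
  refine IsBigO.of_bound (2 * M * (2 / ε) ^ (m + 1)) ?_
  have hfA : ∀ᶠ p in 𝓝 ((z, 0) : Coord n d), p.1 ∈ A := hfst.eventually (hA.mem_nhds hz)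
  filter_upwards [hfA, Metric.ball_mem_nhds _ hε,
    eventually_norm_snd_lt z (show 0 < ε / 4 by positivity)] with p hpA hpb hpw
  obtain ⟨x, w⟩ := p
  simp only at hpA hpw
  rw [Real.norm_of_nonneg (by positivity)]
  rw [Metric.mem_ball, Prod.dist_eq, max_lt_iff] at hpb
  -- Cauchy estimates for `t ↦ g (x, t w)` on the disc of radius `1 / a`, on which `‖g‖ ≤ M`
  by_cases hw : w = 0
  · subst hw
    have h0 : ∀ l, homogPart A l g (x, 0) = if l = 0 then g (x, 0) else 0 := by
      intro l
      rcases l with _ | l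
      · simp [homogPart, hpA]
      · simp [homogPart, hpA, iteratedDeriv_const]
    simp [h0]
  set a : ℝ := ‖w‖ * (2 / ε) with ha
  have hwp : 0 < ‖w‖ := norm_pos_iff.2 hw
  have ha0 : 0 < a := by positivity
  have ha1 : a < 1 / 2 := by
    rw [ha]
    calc ‖w‖ * (2 / ε) < ε / 4 * (2 / ε) := by gcongr
      _ = 1 / 2 := by field_simp; norm_num
  have hin : ∀ t : ℂ, ‖t‖ ≤ a⁻¹ → (x, t • w) ∈ Metric.ball ((z, 0) : Coord n d) ε := by
    intro t ht
    rw [Metric.mem_ball, Prod.dist_eq, max_lt_iff]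
    refine ⟨hpb.1, ?_⟩
    rw [dist_zero_right, norm_smul]
    calc ‖t‖ * ‖w‖ ≤ a⁻¹ * ‖w‖ := by gcongr
      _ = ε / 2 := by rw [ha]; field_simp
      _ < ε := by linarith
  have hdiff : ∀ t : ℂ, ‖t‖ ≤ a⁻¹ → DifferentiableAt ℂ (fun t : ℂ => g (x, t • w)) t := by
    intro t ht
    have := (hball _ (hin t ht)).2.differentiableAt
    exact DifferentiableAt.comp (g := g) (f := fun t : ℂ => ((x, t • w) : Coord n d)) t this
      (by fun_prop)
  have hd : DiffContOnCl ℂ (fun t : ℂ => g (x, t • w)) (Metric.ball 0 a⁻¹) := by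
    refine DifferentiableOn.diffContOnCl fun t ht => ?_
    rw [closure_ball _ (by positivity), mem_closedBall_zero_iff] at ht
    exact (hdiff t ht).differentiableWithinAt
  have hone : (1 : ℂ) ∈ Metric.ball (0 : ℂ) a⁻¹ := by
    rw [mem_ball_zero_iff, norm_one]
    exact (one_lt_inv₀ ha0).2 (by linarith)
  have hsum := Complex.hasSum_taylorSeries_on_ball hd.differentiableOn hone
  simp only [sub_zero, one_pow, one_smul] at hsum
  have hterm : ∀ l, ‖homogPart A l g (x, w)‖ ≤ M * a ^ l := by
    intro l
    have h := Complex.norm_iteratedDeriv_le_of_forall_mem_sphere_norm_le (C := M) l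
      (inv_pos.2 ha0) hd (fun t ht => (hball _ (hin t (by simpa using (le_of_eq
        (mem_sphere_zero_iff_norm.1 ht))))).1.le)
    simp only [homogPart, hpA, if_true, norm_smul, norm_inv, Complex.norm_natCast]
    rw [inv_mul_le_iff₀ (by positivity)]
    refine h.trans (le_of_eq ?_)
    rw [inv_pow, div_inv_eq_mul]
    ring
  have hsum' : HasSum (fun l => homogPart A l g (x, w)) (g (x, w)) := by
    simpa [homogPart, hpA] using hsum
  have htail := (hasSum_nat_add_iff' (m + 1)).2 hsum'
  have hgeo : HasSum (fun l : ℕ => M * a ^ (l + (m + 1))) (M * a ^ (m + 1) * (1 - a)⁻¹) := by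
    have := (hasSum_geometric_of_lt_one ha0.le (by linarith)).mul_left (M * a ^ (m + 1))
    refine this.congr_fun ?_
    intro l
    ring
  have hle := htail.norm_le_of_bounded hgeo fun l => hterm _
  refine hle.trans ?_
  have h2 : (1 - a)⁻¹ ≤ 2 := by
    rw [inv_le_comm₀ (by linarith) (by norm_num)]; linarith
  calc M * a ^ (m + 1) * (1 - a)⁻¹ ≤ M * a ^ (m + 1) * 2 := by gcongr
    _ = 2 * M * (2 / ε) ^ (m + 1) * ‖w‖ ^ (m + 1) := by rw [ha, mul_pow]; ring

variable {l m : ℕ} {A : Set (Fin n → ℂ)}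

theorem Homog.eventually_smul {u : Coord n d → Coord n d} (hu : u ∈ Homog n d l A) (hA : IsOpen A)
    {z : Fin n → ℂ} (hz : z ∈ A) : ∀ᶠ x in 𝓝 z, ∀ (c : ℂ) w, u (x, c • w) = c ^ l • u (x, w) := by
  filter_upwards [hA.mem_nhds hz] with x hx using hu.2.1 x hx

theorem Homog.analyticAt {u : Coord n d → Coord n d} (hu : u ∈ Homog n d l A)
    {z : Fin n → ℂ} (hz : z ∈ A) : AnalyticAt ℂ u (z, 0) := hu.1 _ ⟨hz, trivial⟩

theorem Homog.ordAt {u : Coord n d → Coord n d} (hu : u ∈ Homog n d l A) (hA : IsOpen A)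
    {z : Fin n → ℂ} (hz : z ∈ A) : OrdAt l z u :=
  ordAt_of_homogeneous (Homog.analyticAt hu hz).continuousAt (Homog.eventually_smul hu hA hz)

theorem Homog.eq_zero {u : Coord n d → Coord n d} (hu : u ∈ Homog n d l A)
    (h : ∀ z ∈ A, OrdAt (l + 1) z u) : u = 0 := by
  funext ⟨z, w⟩
  by_cases hz : z ∈ A
  · exact OrdAt.eq_zero_of_homogeneous (hu.2.1 z hz) (h z hz) w
  · exact hu.2.2 z hz w

/-- Uniqueness of the homogeneous terms of an expansion. -/
theorem Homog.eq_zero_of_sum (hA : IsOpen A) {u : ℕ → Coord n d → Coord n d}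
    (hu : ∀ l, u l ∈ Homog n d l A) (m : ℕ)
    (h : ∀ z ∈ A, OrdAt (m + 1) z fun p => ∑ l ∈ Finset.range (m + 1), u l p) :
    ∀ l ≤ m, u l = 0 := by
  induction m with
  | zero =>
    intro l hl
    obtain rfl : l = 0 := by omega
    refine Homog.eq_zero (hu 0) fun z hz => ?_
    simpa using h z hz
  | succ m ih =>
    have hlow : ∀ l ≤ m, u l = 0 := by
      refine ih fun z hz => ?_
      have h1 := (OrdAt.mono (h z hz) (Nat.le_succ (m + 1))).sub
        (Homog.ordAt (hu (m + 1)) hA hz)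
      simpa [Finset.sum_range_succ _ (m + 1)] using h1
    intro l hl
    rcases Nat.lt_or_ge l (m + 1) with h1 | h1
    · exact hlow l (by omega)
    · obtain rfl : l = m + 1 := by omega
      refine Homog.eq_zero (hu (m + 1)) fun z hz => ?_
      have h2 := h z hz
      rw [show (fun p => ∑ l ∈ Finset.range (m + 1 + 1), u l p) = u (m + 1) by
        funext p
        rw [Finset.sum_range_succ, Finset.sum_eq_zero, zero_add]
        intro i hi
        rw [hlow i (by simpa [Nat.lt_succ_iff] using hi)]; rfl] at h2
      exact h2

/-- Homogeneous parts of degree `≤ m` only depend on a map modulo `O(m + 1)`. -/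
theorem homogPart_congr (hA : IsOpen A) {g h : Coord n d → Coord n d}
    (hg : AnalyticOnNhd ℂ g (A ×ˢ {0})) (hh : AnalyticOnNhd ℂ h (A ×ˢ {0}))
    (hgh : ∀ z ∈ A, OrdAt (m + 1) z fun p => g p - h p) (hl : l ≤ m) :
    homogPart A l g = homogPart A l h := by
  have := Homog.eq_zero_of_sum hA (u := fun l => homogPart A l g - homogPart A l h)
    (fun l => sub_mem (homogPart_mem hA l hg) (homogPart_mem hA l hh)) m (fun z hz => ?_) l hl
  · exact sub_eq_zero.1 this
  · have h1 := ((ordAt_sub_sum_homogPart hA hz m (hh _ ⟨hz, rfl⟩)).sub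
      (ordAt_sub_sum_homogPart hA hz m (hg _ ⟨hz, rfl⟩))).add (hgh z hz)
    refine h1.congr_left fun p => ?_
    simp only [Pi.sub_apply, Finset.sum_sub_distrib]
    abel

theorem homogPart_zero (A : Set (Fin n → ℂ)) (l : ℕ) :
    homogPart A l (fun _ : Coord n d => 0) = 0 := by
  funext p
  simp [homogPart]

theorem homogPart_eq_zero (hA : IsOpen A) {g : Coord n d → Coord n d}
    (hg : AnalyticOnNhd ℂ g (A ×ˢ {0})) (h : ∀ z ∈ A, OrdAt m z g) (hl : l < m) :
    homogPart A l g = 0 := by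
  obtain ⟨m, rfl⟩ : ∃ k, m = k + 1 := ⟨m - 1, by omega⟩
  rw [← homogPart_zero A l]
  exact homogPart_congr hA hg (fun _ _ => analyticAt_const) (m := m)
    (fun z hz => by simpa using h z hz) (by omega)

/-- The leading term of a map of order `≥ l`. -/
theorem ordAt_sub_homogPart (hA : IsOpen A) {g : Coord n d → Coord n d}
    (hg : AnalyticOnNhd ℂ g (A ×ˢ {0})) (h : ∀ z ∈ A, OrdAt l z g) {z : Fin n → ℂ} (hz : z ∈ A) :
    OrdAt (l + 1) z fun p => g p - homogPart A l g p := by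
  refine (ordAt_sub_sum_homogPart hA hz l (hg _ ⟨hz, rfl⟩)).congr_left fun p => ?_
  rw [Finset.sum_range_succ, Finset.sum_eq_zero, zero_add]
  intro i hi
  rw [homogPart_eq_zero hA hg h (by simpa using hi)]; rfl

theorem ordAt_sub_of_le {g : ℕ → Coord n d → Coord n d} {z : Fin n → ℂ}
    (hg : ∀ m, OrdAt (m + 1) z fun p => g (m + 1) p - g m p) (h : l ≤ m) :
    OrdAt (l + 1) z fun p => g m p - g l p := by
  induction m, h using Nat.le_induction with
  | base => exact ordAt_of_eventuallyEq_zero (.of_forall fun p => sub_self _)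
  | succ m hm ih =>
    refine ((OrdAt.mono (hg m) (by omega)).add ih).congr_left fun p => ?_
    abel

/-- A coherent sequence of germs has a formal limit: its term of degree `l` can be read off
from the `l`-th germ. -/
theorem ordAt_sum_homogPart_sub (hA : IsOpen A) {g : ℕ → Coord n d → Coord n d}
    (hg : ∀ m, AnalyticOnNhd ℂ (g m) (A ×ˢ {0}))
    (hc : ∀ m, ∀ z ∈ A, OrdAt (m + 1) z fun p => g (m + 1) p - g m p) (m : ℕ)
    {z : Fin n → ℂ} (hz : z ∈ A) :
    OrdAt (m + 1) z fun p => ∑ l ∈ Finset.range (m + 1), homogPart A l (g l) p - g m p := by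
  have h := (ordAt_sub_sum_homogPart hA hz m (hg m _ ⟨hz, rfl⟩)).neg_left
  refine h.congr_left fun p => ?_
  rw [neg_sub]
  congr 1
  refine Finset.sum_congr rfl fun l hl => ?_
  have hlm : l ≤ m := Nat.lt_succ_iff.1 (Finset.mem_range.1 hl)
  rw [homogPart_congr hA (hg m) (hg l)
    (fun z hz => ordAt_sub_of_le (fun m => hc m z hz) hlm) le_rfl]

end Taylor

end FormalNbhd

/-! ### Germs of maps tangent to the identity -/

namespace FormalNbhd

universe u v w

/-- A map that is locally invertible, tangent to the identity, at every point of a set `S` of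
fixed points has one inverse that works near all points of `S`. Near `S` the value `H p` is the
preimage of `p` closest to `p`, so no gluing of the local inverses is needed. -/
theorem exists_germ_inverse {E : Type*} [NormedAddCommGroup E] [NormedSpace ℂ E] [CompleteSpace E]
    {F : E → E} {S : Set E} (hF : ∀ a ∈ S, AnalyticAt ℂ F a) (hfix : ∀ a ∈ S, F a = a)
    (hderiv : ∀ a ∈ S, HasFDerivAt F (ContinuousLinearMap.id ℂ E) a) :
    ∃ H : E → E, ∀ a ∈ S, AnalyticAt ℂ H a ∧ H a = a ∧ (∀ᶠ p in 𝓝 a, H (F p) = p) ∧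
      ∀ᶠ p in 𝓝 a, F (H p) = p := by
  classical
  refine ⟨fun p => if h : ∃ q, F q = p ∧ ∀ q', F q' = p → q' ≠ q → ‖q - p‖ < ‖q' - p‖
    then h.choose else p, fun a ha => ?_⟩
  generalize hH : (fun p => if h : ∃ q, F q = p ∧ ∀ q', F q' = p → q' ≠ q → ‖q - p‖ < ‖q' - p‖
    then h.choose else p) = H
  have hd' : HasFDerivAt F ((ContinuousLinearEquiv.refl ℂ E : E ≃L[ℂ] E) : E →L[ℂ] E) a :=
    hderiv a ha
  have hs : HasStrictFDerivAt F ((ContinuousLinearEquiv.refl ℂ E : E ≃L[ℂ] E) : E →L[ℂ] E) a := by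
    have := (hF a ha).hasStrictFDerivAt
    rwa [(hderiv a ha).fderiv] at this
  have hcd : ContDiffAt ℂ ω F a := (hF a ha).contDiffAt
  set g := hs.localInverse F _ a with hg
  have hgF : ∀ᶠ p in 𝓝 a, g (F p) = p := hs.eventually_left_inverse
  have hFg : ∀ᶠ p in 𝓝 a, F (g p) = p := by
    have := hs.eventually_right_inverse
    rwa [hfix a ha] at this
  have hga : AnalyticAt ℂ g a := by
    have h := (hcd.to_localInverse hd' (by simp)).analyticAt
    rwa [hfix a ha] at h
  have hgaa : g a = a := by
    have := hgF.self_of_nhds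
    rwa [hfix a ha] at this
  obtain ⟨r, hr, hball⟩ := Metric.eventually_nhds_iff_ball.1 hgF
  have hgt : Filter.Tendsto g (𝓝 a) (𝓝 a) := by
    have := hga.continuousAt.tendsto
    rwa [hgaa] at this
  have hHg : H =ᶠ[𝓝 a] g := by
    filter_upwards [hFg, hgt (Metric.ball_mem_nhds a (show 0 < r / 4 by positivity)),
      Metric.ball_mem_nhds a (show 0 < r / 4 by positivity)] with p hp1 hp2 hp3
    have hp2' : ‖g p - a‖ < r / 4 := by simpa [dist_eq_norm] using hp2
    have hp3' : ‖p - a‖ < r / 4 := by simpa [dist_eq_norm] using hp3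
    have hclose : ‖g p - p‖ < r / 2 := by
      calc ‖g p - p‖ = ‖(g p - a) - (p - a)‖ := by congr 1; abel
        _ ≤ ‖g p - a‖ + ‖p - a‖ := norm_sub_le _ _
        _ < r / 2 := by linarith
    have hmin : ∀ q', F q' = p → q' ≠ g p → ‖g p - p‖ < ‖q' - p‖ := by
      intro q' hq' hne
      by_contra hcon
      apply hne
      have hq : q' ∈ Metric.ball a r := by
        rw [Metric.mem_ball, dist_eq_norm]
        calc ‖q' - a‖ = ‖(q' - p) + (p - a)‖ := by congr 1; abel
          _ ≤ ‖q' - p‖ + ‖p - a‖ := norm_add_le _ _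
          _ < r := by linarith
      rw [← hball q' hq, hq']
    have hex : ∃ q, F q = p ∧ ∀ q', F q' = p → q' ≠ q → ‖q - p‖ < ‖q' - p‖ := ⟨g p, hp1, hmin⟩
    have hHp : H p = hex.choose := by rw [← hH]; exact dif_pos hex
    rw [hHp]
    by_contra hne
    have h1 := hmin _ hex.choose_spec.1 hne
    have h2 := hex.choose_spec.2 (g p) hp1 (Ne.symm hne)
    exact lt_asymm h1 h2
  refine ⟨hga.congr hHg.symm, hHg.self_of_nhds.trans hgaa, ?_, ?_⟩
  · have hFt : Filter.Tendsto F (𝓝 a) (𝓝 a) := by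
      have := (hF a ha).continuousAt.tendsto
      rwa [hfix a ha] at this
    filter_upwards [hgF, hFt.eventually hHg] with p h1 h2
    rw [h2, h1]
  · filter_upwards [hFg, hHg] with p h1 h2
    rw [h2, h1]

variable {n d : ℕ} {C : Type u} [TopologicalSpace C] [ChartedSpace (Fin n → ℂ) C] {ι : Type v}
  {𝒰 : PolydiscCover n C ι}

namespace PolydiscCover

variable (𝒰)

theorem isOpen_dom (j : ι) : IsOpen (𝒰.dom j) := (𝒰.chart j).open_target

theorem isOpen_overlap (k j : ι) : IsOpen (𝒰.overlap k j) :=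
  (𝒰.chart j).isOpen_inter_preimage_symm (𝒰.chart k).open_source

variable {𝒰} {k j i : ι} {z : Fin n → ℂ}

theorem trans_mem_dom (hz : z ∈ 𝒰.overlap k j) : 𝒰.trans k j z ∈ 𝒰.dom k :=
  (𝒰.chart k).map_source hz.2

theorem symm_trans (hz : z ∈ 𝒰.overlap k j) :
    (𝒰.chart k).symm (𝒰.trans k j z) = (𝒰.chart j).symm z :=
  (𝒰.chart k).left_inv hz.2

theorem trans_mem_overlap (hz : z ∈ 𝒰.triple k j i) : 𝒰.trans j i z ∈ 𝒰.overlap k j :=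
  ⟨trans_mem_dom hz.2, by rw [symm_trans hz.2]; exact hz.1.2⟩

end PolydiscCover

namespace Neighborhood

variable (Φ : Neighborhood 𝒰 d) {k j i : ι} {z : Fin n → ℂ}

theorem analyticAt (hz : z ∈ 𝒰.overlap k j) : AnalyticAt ℂ (Φ.toFun k j) (z, 0) :=
  Φ.analytic k j _ ⟨hz, rfl⟩

theorem adaptedAt (hz : z ∈ 𝒰.overlap k j) : AdaptedAt (Φ.toFun k j) z (𝒰.trans k j z) := by
  constructor
  · have := (Φ.analyticAt hz).continuousAt.tendsto
    rwa [Φ.base k j z hz] at this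
  · refine ordAt_one_of_analyticAt (analyticAt_snd.comp (Φ.analyticAt hz)) ?_
    filter_upwards [(𝒰.isOpen_overlap k j).mem_nhds hz] with x hx
    change (Φ.toFun k j (x, 0)).2 = 0
    rw [Φ.base k j x hx]

end Neighborhood

/-- A family of germs `G_j = I + O(2)` along `U_j × {0}`. -/
structure IsTangent (𝒰 : PolydiscCover n C ι) (G : ι → Coord n d → Coord n d) : Prop where
  analyticAt : ∀ j, ∀ z ∈ 𝒰.dom j, AnalyticAt ℂ (G j) (z, 0)
  tangent : ∀ j, ∀ z ∈ 𝒰.dom j, OrdAt 2 z fun p => G j p - p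

namespace IsTangent

variable {G H : ι → Coord n d → Coord n d} {j : ι} {z : Fin n → ℂ} {l m : ℕ}

theorem adaptedAt (hG : IsTangent 𝒰 G) (hz : z ∈ 𝒰.dom j) : AdaptedAt (G j) z z := by
  refine (adaptedAt_id z).of_ordAt_sub ?_
  simpa using (OrdAt.mono (hG.tangent j z hz) one_le_two).neg_left

theorem apply_zero (hG : IsTangent 𝒰 G) (hz : z ∈ 𝒰.dom j) : G j (z, 0) = (z, 0) :=
  sub_eq_zero.1 (OrdAt.apply_eq_zero (g := fun p => G j p - p) (hG.tangent j z hz) two_ne_zero)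

theorem id : IsTangent 𝒰 (fun _ p => p : ι → Coord n d → Coord n d) :=
  ⟨fun _ _ _ => analyticAt_id, fun _ _ _ => ordAt_of_eventuallyEq_zero (.of_forall fun _ => sub_self _)⟩

theorem comp (hG : IsTangent 𝒰 G) (hH : IsTangent 𝒰 H) : IsTangent 𝒰 fun j p => G j (H j p) := by
  constructor
  · intro j z hz
    exact AnalyticAt.comp_of_eq (hG.analyticAt j z hz) (hH.analyticAt j z hz) (hH.apply_zero hz)
  · intro j z hz
    have h := (OrdAt.comp (hG.tangent j z hz) (hH.adaptedAt hz)).add (hH.tangent j z hz)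
    simpa using h

theorem add_homog (hG : IsTangent 𝒰 G) {f : ι → Coord n d → Coord n d} (hf : f ∈ cochain0 𝒰 d l)
    (hl : 2 ≤ l) : IsTangent 𝒰 fun j p => G j p + f j p := by
  constructor
  · intro j z hz
    exact (hG.analyticAt j z hz).add (Homog.analyticAt (hf j) hz)
  · intro j z hz
    have h := (hG.tangent j z hz).add (OrdAt.mono (Homog.ordAt (hf j) (𝒰.isOpen_dom j) hz) hl)
    refine h.congr_left fun p => ?_
    abel

theorem exists_inverse (hG : IsTangent 𝒰 G) : ∃ H, IsTangent 𝒰 H ∧ ∀ j, ∀ z ∈ 𝒰.dom j,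
    (∀ᶠ p in 𝓝 ((z, 0) : Coord n d), H j (G j p) = p) ∧
      ∀ᶠ p in 𝓝 ((z, 0) : Coord n d), G j (H j p) = p := by
  have h : ∀ j, ∃ H : Coord n d → Coord n d, ∀ a ∈ 𝒰.dom j ×ˢ {0}, AnalyticAt ℂ H a ∧ H a = a ∧
      (∀ᶠ p in 𝓝 a, H (G j p) = p) ∧ ∀ᶠ p in 𝓝 a, G j (H p) = p := by
    intro j
    refine exists_germ_inverse ?_ ?_ ?_
    · rintro ⟨z, w⟩ ⟨hz, rfl⟩
      exact hG.analyticAt j z hz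
    · rintro ⟨z, w⟩ ⟨hz, rfl⟩
      exact hG.apply_zero hz
    · rintro ⟨z, w⟩ ⟨hz, rfl⟩
      have h1 := (OrdAt.hasFDerivAt_zero (hG.tangent j z hz)).add
        (hasFDerivAt_id (𝕜 := ℂ) ((z, 0) : Coord n d))
      rw [zero_add] at h1
      refine h1.congr_of_eventuallyEq (.of_forall fun p => ?_)
      simp
  choose H hH using h
  refine ⟨H, ⟨fun j z hz => (hH j (z, 0) ⟨hz, rfl⟩).1, fun j z hz => ?_⟩,
    fun j z hz => (hH j (z, 0) ⟨hz, rfl⟩).2.2⟩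
  obtain ⟨h1, h2, h3, h4⟩ := hH j (z, 0) ⟨hz, rfl⟩
  have hA : AdaptedAt (H j) z z := by
    refine ⟨?_, ordAt_one_of_analyticAt (analyticAt_snd.comp h1) ?_⟩
    · have := h1.continuousAt.tendsto
      rwa [h2] at this
    · filter_upwards [(𝒰.isOpen_dom j).mem_nhds hz] with x hx
      change (H j (x, 0)).2 = 0
      rw [(hH j (x, 0) ⟨hx, rfl⟩).2.1]
  have h5 := (OrdAt.comp (hG.tangent j z hz) hA).neg_left
  refine h5.congr' ?_ .rfl
  filter_upwards [h4] with p hp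
  rw [hp, neg_sub]

/-- Inverses of germs that agree modulo `O(l)` agree modulo `O(l)`. -/
theorem ordAt_inverse_sub {G' H' : ι → Coord n d → Coord n d} (hH : IsTangent 𝒰 H)
    (hG : IsTangent 𝒰 G) (hG' : IsTangent 𝒰 G') (hH' : IsTangent 𝒰 H') (hz : z ∈ 𝒰.dom j)
    (hHG : ∀ᶠ p in 𝓝 ((z, 0) : Coord n d), H j (G j p) = p)
    (hGH' : ∀ᶠ p in 𝓝 ((z, 0) : Coord n d), G' j (H' j p) = p)
    (h : OrdAt l z fun p => G' j p - G j p) : OrdAt l z fun p => H' j p - H j p := by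
  have h1 := OrdAt.comp_sub_comp (hH.analyticAt j z hz)
    ((hG'.adaptedAt hz).comp (hH'.adaptedAt hz)).tendsto
    ((hG.adaptedAt hz).comp (hH'.adaptedAt hz)).tendsto (OrdAt.comp h (hH'.adaptedAt hz))
  refine h1.neg_left.congr' ?_ .rfl
  filter_upwards [(hH'.adaptedAt hz).tendsto.eventually hHG, hGH'] with p h2 h3
  rw [h2, h3, neg_sub]

end IsTangent

namespace FormalMap

theorem isTangent_trunc (F : FormalMap 𝒰 d) (m : ℕ) : IsTangent 𝒰 (F.trunc m) := by
  have hsub : ∀ j p, F.trunc m j p - p = ∑ l ∈ Finset.range (m + 1), F.term l j p :=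
    fun j p => by rw [trunc, add_sub_cancel_left]
  constructor
  · intro j z hz
    exact analyticAt_id.add (Finset.analyticAt_fun_sum _ fun l _ =>
      Homog.analyticAt (F.term_mem l j) hz)
  · intro j z hz
    simp only [hsub]
    suffices h : ∀ l ∈ Finset.range (m + 1), OrdAt 2 z fun p => F.term l j p from IsBigO.fun_sum h
    intro l _
    rcases l with _ | _ | l
    · rw [F.term_zero]; exact ordAt_of_eventuallyEq_zero .rfl
    · rw [zero_add, F.term_one]; exact ordAt_of_eventuallyEq_zero .rfl
    · exact OrdAt.mono (Homog.ordAt (F.term_mem (l + 2) j) (𝒰.isOpen_dom j) hz) (by omega)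

theorem trunc_succ (F : FormalMap 𝒰 d) (m : ℕ) (j : ι) (p : Coord n d) :
    F.trunc (m + 1) j p = F.trunc m j p + F.term (m + 1) j p := by
  rw [trunc, trunc, Finset.sum_range_succ _ (m + 1), add_assoc]

/-- A coherent sequence of germs tangent to the identity converges to a formal mapping. -/
theorem exists_of_seq {G : ℕ → ι → Coord n d → Coord n d} (hG : ∀ m, IsTangent 𝒰 (G m))
    (hc : ∀ m j, ∀ z ∈ 𝒰.dom j, OrdAt (m + 1) z fun p => G (m + 1) j p - G m j p) :
    ∃ F : FormalMap 𝒰 d, ∀ m j, ∀ z ∈ 𝒰.dom j, OrdAt (m + 1) z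
      fun p => F.trunc m j p - G m j p := by
  have hA : ∀ m j, AnalyticOnNhd ℂ (fun p => G m j p - p) (𝒰.dom j ×ˢ {0}) := by
    rintro m j ⟨z, w⟩ ⟨hz, rfl⟩
    exact ((hG m).analyticAt j z hz).sub analyticAt_id
  refine ⟨⟨fun l j => homogPart (𝒰.dom j) l fun p => G l j p - p,
    fun l j => homogPart_mem (𝒰.isOpen_dom j) l (hA l j), ?_, ?_⟩, fun m j z hz => ?_⟩
  · funext j
    exact homogPart_eq_zero (𝒰.isOpen_dom j) (hA 0 j) ((hG 0).tangent j) (by norm_num)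
  · funext j
    exact homogPart_eq_zero (𝒰.isOpen_dom j) (hA 1 j) ((hG 1).tangent j) (by norm_num)
  · have h := ordAt_sum_homogPart_sub (𝒰.isOpen_dom j) (fun m => hA m j)
      (fun m z hz => by simpa using hc m j z hz) m hz
    refine h.congr_left fun p => ?_
    simp only [trunc]
    abel

/-- The formal mapping with terms of degree `≤ m` those of `F` and with the single further term
`f` of degree `m + 1`. -/
def extend (F : FormalMap 𝒰 d) {m : ℕ} (hm : 1 ≤ m) {f : ι → Coord n d → Coord n d}
    (hf : f ∈ cochain0 𝒰 d (m + 1)) : FormalMap 𝒰 d where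
  term l := if l ≤ m then F.term l else if l = m + 1 then f else 0
  term_mem l := by
    split_ifs with h1 h2
    · exact F.term_mem l
    · subst h2; exact hf
    · exact zero_mem _
  term_zero := by simp [F.term_zero]
  term_one := by simp [hm, F.term_one]

variable {F : FormalMap 𝒰 d} {m : ℕ} {hm : 1 ≤ m} {f : ι → Coord n d → Coord n d}
  {hf : f ∈ cochain0 𝒰 d (m + 1)}

theorem extend_term_of_le {l : ℕ} (hl : l ≤ m) : (F.extend hm hf).term l = F.term l :=
  if_pos hl

theorem trunc_extend (j : ι) (p : Coord n d) :
    (F.extend hm hf).trunc (m + 1) j p = F.trunc m j p + f j p := by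
  rw [trunc_succ]
  congr 1
  · simp only [trunc]
    congr 1
    refine Finset.sum_congr rfl fun l hl => ?_
    rw [extend_term_of_le (Nat.lt_succ_iff.1 (Finset.mem_range.1 hl))]
  · simp [extend]

end FormalMap

/-! ### Conjugacy modulo terms of high order -/

/-- `G Φ G⁻¹ = Ψ + O(m + 1)`, for a family of germs `G_j`. For the truncation of a formal mapping
in degree `m` this is `ConjMod m`. -/
def GermConj (m : ℕ) (G : ι → Coord n d → Coord n d) (Φ Ψ : Neighborhood 𝒰 d) : Prop :=
  ∀ k j, VanishesTo (m + 1) (𝒰.overlap k j) fun p => G k (Φ.toFun k j p) - Ψ.toFun k j (G j p)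

namespace GermConj

variable {G H : ι → Coord n d → Coord n d} {Φ Ψ X : Neighborhood 𝒰 d} {m : ℕ}

theorem of_congr (h : GermConj m G Φ Ψ) (hG : IsTangent 𝒰 G) (hH : IsTangent 𝒰 H)
    (hGH : ∀ j, ∀ z ∈ 𝒰.dom j, OrdAt (m + 1) z fun p => H j p - G j p) : GermConj m H Φ Ψ := by
  intro k j z hz
  have h1 := OrdAt.comp (hGH k _ (𝒰.trans_mem_dom hz)) (Φ.adaptedAt hz)
  have h2 := OrdAt.comp_sub_comp (Ψ.analyticAt hz) (hH.adaptedAt hz.1).tendsto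
    (hG.adaptedAt hz.1).tendsto (hGH j z hz.1)
  refine ((h1.sub h2).add (h k j z hz)).congr_left fun p => ?_
  abel

theorem of_congr_target (h : GermConj m G Φ Ψ) (hG : IsTangent 𝒰 G)
    (hX : ∀ k j, ∀ z ∈ 𝒰.overlap k j, OrdAt (m + 1) z fun p => X.toFun k j p - Ψ.toFun k j p) :
    GermConj m G Φ X := by
  intro k j z hz
  have h1 := OrdAt.comp (hX k j z hz) (hG.adaptedAt hz.1)
  refine (IsBigO.sub (h k j z hz) h1).congr_left fun p => ?_
  abel

theorem of_congr_source (h : GermConj m G Φ Ψ) (hG : IsTangent 𝒰 G)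
    (hX : ∀ k j, ∀ z ∈ 𝒰.overlap k j, OrdAt (m + 1) z fun p => X.toFun k j p - Φ.toFun k j p) :
    GermConj m G X Ψ := by
  intro k j z hz
  have h1 := OrdAt.comp_sub_comp (hG.analyticAt k _ (𝒰.trans_mem_dom hz)) (X.adaptedAt hz).tendsto
    (Φ.adaptedAt hz).tendsto (hX k j z hz)
  refine (IsBigO.add h1 (h k j z hz)).congr_left fun p => ?_
  abel

theorem comp (hH : IsTangent 𝒰 H) (hG : IsTangent 𝒰 G) (h : GermConj m H Ψ X)
    (h' : GermConj m G Φ Ψ) : GermConj m (fun j p => H j (G j p)) Φ X := by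
  intro k j z hz
  have hk := 𝒰.trans_mem_dom hz
  have h1 := OrdAt.comp_sub_comp (hH.analyticAt k _ hk)
    ((hG.adaptedAt hk).comp (Φ.adaptedAt hz)).tendsto
    ((Ψ.adaptedAt hz).comp (hG.adaptedAt hz.1)).tendsto (h' k j z hz)
  have h2 := OrdAt.comp (h k j z hz) (hG.adaptedAt hz.1)
  refine (h1.add h2).congr_left fun p => ?_
  abel

theorem inverse (hH : IsTangent 𝒰 H) (hG : IsTangent 𝒰 G) (h : GermConj m G Φ Ψ)
    (hinv : ∀ j, ∀ z ∈ 𝒰.dom j, (∀ᶠ p in 𝓝 ((z, 0) : Coord n d), H j (G j p) = p) ∧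
      ∀ᶠ p in 𝓝 ((z, 0) : Coord n d), G j (H j p) = p) : GermConj m H Ψ Φ := by
  intro k j z hz
  have hk := 𝒰.trans_mem_dom hz
  have hΦH := (Φ.adaptedAt hz).comp (hH.adaptedAt hz.1)
  have h1 := OrdAt.comp_sub_comp (hH.analyticAt k _ hk)
    ((hG.adaptedAt hk).comp hΦH).tendsto
    ((Ψ.adaptedAt hz).comp ((hG.adaptedAt hz.1).comp (hH.adaptedAt hz.1))).tendsto
    (OrdAt.comp (h k j z hz) (hH.adaptedAt hz.1))
  refine h1.neg_left.congr' ?_ .rfl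
  filter_upwards [(hinv j z hz.1).2, hΦH.tendsto.eventually (hinv k _ hk).1] with p h2 h3
  rw [h2, h3, neg_sub]

theorem refl : GermConj m (fun _ p => p) Φ Φ := fun _ _ _ _ =>
  ordAt_of_eventuallyEq_zero (.of_forall fun _ => sub_self _)

theorem mono {l : ℕ} (h : GermConj m G Φ Ψ) (hl : l ≤ m) : GermConj l G Φ Ψ :=
  fun k j z hz => OrdAt.mono (h k j z hz) (by omega)

end GermConj

variable {N₁ : Neighborhood 𝒰 d}

theorem Moduli.ordAt_sub (Φ Ψ : Moduli N₁) {k j : ι} {z : Fin n → ℂ} (hz : z ∈ 𝒰.overlap k j) :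
    OrdAt 2 z fun p => Φ.1.toFun k j p - Ψ.1.toFun k j p := by
  refine (IsBigO.sub (Φ.2 k j z hz) (Ψ.2 k j z hz)).congr_left fun p => ?_
  abel

/-- Any germs tangent to the identity conjugate elements of `𝓜` modulo `O(2)`. -/
theorem IsTangent.ordAt_conj {G : ι → Coord n d → Coord n d} (hG : IsTangent 𝒰 G)
    (Φ Ψ : Moduli N₁) {k j : ι} {z : Fin n → ℂ} (hz : z ∈ 𝒰.overlap k j) :
    OrdAt 2 z fun p => G k (Φ.1.toFun k j p) - Ψ.1.toFun k j (G j p) := by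
  have h1 := OrdAt.comp (hG.tangent k _ (𝒰.trans_mem_dom hz)) (Φ.1.adaptedAt hz)
  have h2 := OrdAt.comp_sub_comp (Ψ.1.analyticAt hz) (hG.adaptedAt hz.1).tendsto
    (Filter.tendsto_id) (hG.tangent j z hz.1)
  refine ((h1.sub h2).add (Φ.ordAt_sub Ψ hz)).congr_left fun p => ?_
  simp only [_root_.id]
  abel

theorem conjMod_of_le_one {m : ℕ} (hm : m ≤ 1) (F : FormalMap 𝒰 d) (Φ Ψ : Moduli N₁) :
    ConjMod m F Φ.1.toFun Ψ.1.toFun := fun _ _ _ hz =>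
  OrdAt.mono ((F.isTangent_trunc m).ordAt_conj Φ Ψ hz) (by omega)

/-- Germs tangent to the identity act on `𝓜` by exact conjugation. -/
theorem Moduli.exists_conj (Φ : Moduli N₁) {G : ι → Coord n d → Coord n d} (hG : IsTangent 𝒰 G) :
    ∃ Ψ : Moduli N₁, ∀ k j, ∀ z ∈ 𝒰.overlap k j, ∀ᶠ p in 𝓝 ((z, 0) : Coord n d),
      Ψ.1.toFun k j (G j p) = G k (Φ.1.toFun k j p) := by
  obtain ⟨H, hH, hinv⟩ := hG.exists_inverse
  have had : ∀ {k j z}, z ∈ 𝒰.overlap k j →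
      AdaptedAt (fun p => Φ.1.toFun k j (H j p)) z (𝒰.trans k j z) := fun hz =>
    (Φ.1.adaptedAt hz).comp (hH.adaptedAt hz.1)
  refine ⟨⟨⟨fun k j p => G k (Φ.1.toFun k j (H j p)), ?_, ?_, ?_, ?_⟩, ?_⟩, ?_⟩
  · rintro k j ⟨z, w⟩ ⟨hz, rfl⟩
    refine AnalyticAt.comp_of_eq (hG.analyticAt k _ (𝒰.trans_mem_dom hz))
      (AnalyticAt.comp_of_eq (Φ.1.analyticAt hz) (hH.analyticAt j z hz.1)
      (hH.apply_zero hz.1)) ?_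
    rw [hH.apply_zero hz.1, Φ.1.base k j z hz]
  · intro k j z hz
    rw [hH.apply_zero hz.1, Φ.1.base k j z hz, hG.apply_zero (𝒰.trans_mem_dom hz)]
  · intro j z hz
    filter_upwards [(hinv j z hz).2, (hH.adaptedAt hz).tendsto.eventually (Φ.1.self j z hz)]
      with p h1 h2
    rw [h2, id, h1, id]
  · intro k j i z hz
    filter_upwards [(had hz.2).tendsto.eventually (hinv j _ (𝒰.trans_mem_dom hz.2)).1,
      (hH.adaptedAt hz.1.1).tendsto.eventually (Φ.1.cocycle k j i z hz)] with p h1 h2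
    rw [Function.comp] at h2 ⊢
    rw [h1, h2]
  · intro k j z hz
    have h1 := OrdAt.comp (hG.ordAt_conj Φ (Moduli.base N₁) hz) (hH.adaptedAt hz.1)
    refine h1.congr' ?_ .rfl
    filter_upwards [(hinv j z hz.1).2] with p hp
    simp only [hp]
    rfl
  · intro k j z hz
    filter_upwards [(hinv j z hz.1).1] with p hp
    simp only [hp]

/-- Conjugacy of `Φ` and `Ψ` modulo `O(m + 1)` by a formal mapping. -/
def EquivMod (m : ℕ) (Φ Ψ : Moduli N₁) : Prop :=
  ∃ F : FormalMap 𝒰 d, ConjMod m F Φ.1.toFun Ψ.1.toFun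

theorem EquivMod.of_germConj {m : ℕ} {Φ Ψ : Moduli N₁} {G : ι → Coord n d → Coord n d}
    (hG : IsTangent 𝒰 G) (h : GermConj m G Φ.1 Ψ.1) : EquivMod m Φ Ψ := by
  obtain ⟨F, hF⟩ := FormalMap.exists_of_seq (G := fun _ => G) (fun _ => hG) (fun m j z _ =>
    ordAt_of_eventuallyEq_zero (.of_forall fun _ => sub_self _))
  exact ⟨F, h.of_congr hG (F.isTangent_trunc m) (hF m)⟩

theorem EquivMod.refl (m : ℕ) (Φ : Moduli N₁) : EquivMod m Φ Φ :=
  .of_germConj .id .refl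

theorem EquivMod.of_ordAt {m : ℕ} {Φ Ψ : Moduli N₁}
    (h : ∀ k j, ∀ z ∈ 𝒰.overlap k j, OrdAt (m + 1) z
      fun p => Ψ.1.toFun k j p - Φ.1.toFun k j p) : EquivMod m Φ Ψ :=
  .of_germConj .id (GermConj.refl.of_congr_target .id h)

theorem EquivMod.symm {m : ℕ} {Φ Ψ : Moduli N₁} : EquivMod m Φ Ψ → EquivMod m Ψ Φ := by
  rintro ⟨F, hF⟩
  obtain ⟨H, hH, hinv⟩ := (F.isTangent_trunc m).exists_inverse
  exact .of_germConj hH (GermConj.inverse hH (F.isTangent_trunc m) hF hinv)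

theorem EquivMod.trans {m : ℕ} {Φ Ψ X : Moduli N₁} :
    EquivMod m Φ Ψ → EquivMod m Ψ X → EquivMod m Φ X := by
  rintro ⟨F, hF⟩ ⟨G, hG⟩
  exact .of_germConj ((G.isTangent_trunc m).comp (F.isTangent_trunc m))
    (GermConj.comp (G.isTangent_trunc m) (F.isTangent_trunc m) hG hF)

/-- Neighborhoods that formal mappings carry to the same coherent data are formally equivalent. -/
theorem formalEquiv_of_conjMod {Φ Ψ : Moduli N₁} {N : ℕ → Moduli N₁} {F G : FormalMap 𝒰 d}
    (hF : ∀ m, ConjMod m F Φ.1.toFun (N m).1.toFun)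
    (hG : ∀ m, ConjMod m G Ψ.1.toFun (N m).1.toFun) : FormalEquiv N₁ Φ Ψ := by
  choose H hH hinv using fun m => (G.isTangent_trunc m).exists_inverse
  have hsucc : ∀ (F : FormalMap 𝒰 d) m j, ∀ z ∈ 𝒰.dom j, OrdAt (m + 1) z
      fun p => F.trunc (m + 1) j p - F.trunc m j p := by
    intro F m j z hz
    simpa [F.trunc_succ] using Homog.ordAt (F.term_mem (m + 1) j) (𝒰.isOpen_dom j) hz
  have hK : ∀ m, IsTangent 𝒰 fun j p => H m j (F.trunc m j p) := fun m =>
    (hH m).comp (F.isTangent_trunc m)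
  obtain ⟨K, hKF⟩ := FormalMap.exists_of_seq hK (fun m j z hz => by
    have hF1 := (F.isTangent_trunc (m + 1)).adaptedAt hz
    have h1 := OrdAt.comp_sub_comp ((hH m).analyticAt j z hz) hF1.tendsto
      ((F.isTangent_trunc m).adaptedAt hz).tendsto (hsucc F m j z hz)
    have h2 := OrdAt.comp ((hH m).ordAt_inverse_sub (G.isTangent_trunc m)
      (G.isTangent_trunc (m + 1)) (hH (m + 1)) hz (hinv m j z hz).1 (hinv (m + 1) j z hz).2
      (hsucc G m j z hz)) hF1
    refine (h1.add h2).congr_left fun p => ?_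
    abel)
  refine ⟨K, fun m => ?_⟩
  have h1 : GermConj m (H m) (N m).1 Ψ.1 :=
    GermConj.inverse (hH m) (G.isTangent_trunc m) (hG m) (hinv m)
  exact (GermConj.comp (hH m) (F.isTangent_trunc m) h1 (hF m)).of_congr (hK m)
    (K.isTangent_trunc m) (hKF m)

theorem formalEquiv_equivalence (N₁ : Neighborhood 𝒰 d) : Equivalence (FormalEquiv N₁) := by
  obtain ⟨I, hI⟩ : ∃ I : FormalMap 𝒰 d, ∀ (Φ : Moduli N₁) m,
      ConjMod m I Φ.1.toFun Φ.1.toFun := by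
    refine ⟨⟨0, fun _ => zero_mem _, rfl, rfl⟩, fun Φ m k j z hz => ?_⟩
    refine ordAt_of_eventuallyEq_zero (.of_forall fun p => ?_)
    simp [FormalMap.trunc]
  have symm : ∀ {Φ Ψ : Moduli N₁}, FormalEquiv N₁ Φ Ψ → FormalEquiv N₁ Ψ Φ := by
    rintro Φ Ψ ⟨F, hF⟩
    exact formalEquiv_of_conjMod (N := fun _ => Ψ) (hI Ψ) hF
  refine ⟨fun Φ => ⟨I, hI Φ⟩, symm, fun h h' => ?_⟩
  obtain ⟨F, hF⟩ := h
  obtain ⟨G, hG⟩ := symm h'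
  exact formalEquiv_of_conjMod (N := fun _ => _) hF hG

end FormalNbhd

/-! ### The linearized conjugacy equation -/

namespace FormalNbhd

universe u v w

variable {n d : ℕ} {C : Type u} [TopologicalSpace C] [ChartedSpace (Fin n → ℂ) C] {ι : Type v}
  {𝒰 : PolydiscCover n C ι}

theorem tendsto_fst_zero (z : Fin n → ℂ) :
    Filter.Tendsto (fun p : Coord n d => p.1) (𝓝 (z, 0)) (𝓝 z) := continuous_fst.tendsto _

theorem ordAt_sub_fst (z : Fin n → ℂ) : OrdAt 1 z fun p : Coord n d => p - (p.1, 0) :=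
  IsBigO.of_bound 1 (.of_forall fun p => by simp [Prod.norm_def])

theorem tendsto_fst_zero_prod (z : Fin n → ℂ) :
    Filter.Tendsto (fun p : Coord n d => ((p.1, 0) : Coord n d)) (𝓝 (z, 0)) (𝓝 (z, 0)) :=
  (tendsto_fst_zero z).prodMk_nhds tendsto_const_nhds

theorem PolydiscCover.tendsto_trans {k j : ι} {z : Fin n → ℂ} (hz : z ∈ 𝒰.overlap k j) :
    Filter.Tendsto (𝒰.trans k j) (𝓝 z) (𝓝 (𝒰.trans k j z)) :=
  ((𝒰.chart k).continuousAt hz.2).comp ((𝒰.chart j).symm.continuousAt hz.1)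

theorem Neighborhood.eventually_base (Φ : Neighborhood 𝒰 d) {k j : ι} {z : Fin n → ℂ}
    (hz : z ∈ 𝒰.overlap k j) : ∀ᶠ p in 𝓝 ((z, 0) : Coord n d),
      Φ.toFun k j (p.1, 0) = (𝒰.trans k j p.1, 0) := by
  have h : ∀ᶠ x in 𝓝 z, Φ.toFun k j (x, 0) = (𝒰.trans k j x, 0) := by
    filter_upwards [(𝒰.isOpen_overlap k j).mem_nhds hz] with x hx using Φ.base k j x hx
  exact (tendsto_fst_zero z).eventually h

theorem Neighborhood.ordAt_sub_base (Φ : Neighborhood 𝒰 d) {k j : ι} {z : Fin n → ℂ}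
    (hz : z ∈ 𝒰.overlap k j) :
    OrdAt 1 z fun p : Coord n d => Φ.toFun k j p - (𝒰.trans k j p.1, 0) := by
  have h := OrdAt.comp_sub_comp (Φ.analyticAt hz) Filter.tendsto_id (tendsto_fst_zero_prod z)
    (ordAt_sub_fst z)
  refine h.congr' ?_ .rfl
  filter_upwards [Φ.eventually_base hz] with p hp
  rw [hp, id]

variable {N₁ : Neighborhood 𝒰 d} {k j i : ι} {z : Fin n → ℂ} {l m : ℕ}

theorem Moduli.fderiv_eq (Φ : Moduli N₁) (hz : z ∈ 𝒰.overlap k j) :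
    fderiv ℂ (Φ.1.toFun k j) (z, 0) = tangentTrans N₁ k j z := by
  have h := (OrdAt.hasFDerivAt_zero (Φ.2 k j z hz)).add
    (N₁.analyticAt hz).differentiableAt.hasFDerivAt
  rw [zero_add] at h
  refine (h.congr_of_eventuallyEq (.of_forall fun p => ?_)).fderiv
  simp

/-- To first order in `w`, the transition functions are those of the normal bundle, up to a
term `O(|w|)` along `C`. -/
theorem Moduli.ordAt_sub_normalTrans (Φ : Moduli N₁) (hz : z ∈ 𝒰.overlap k j) :
    OrdAt 1 z (fun p => (Φ.1.toFun k j p).1 - (normalTrans N₁ k j p).1) ∧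
      OrdAt 2 z fun p => (Φ.1.toFun k j p).2 - (normalTrans N₁ k j p).2 := by
  constructor
  · exact OrdAt.fst (Φ.1.ordAt_sub_base hz)
  · have h := OrdAt.comp_sub_comp_sub_fderiv (A := fun p => p) (N₁.analyticAt hz)
      (tendsto_fst_zero_prod z) (ordAt_sub_fst z)
      (ordAt_of_eventuallyEq_zero (.of_forall fun p => sub_self _)) (ordAt_sub_fst z)
    have h1 : OrdAt 2 z fun p => (N₁.toFun k j p).2 - (normalTrans N₁ k j p).2 := by
      refine (OrdAt.snd h).congr' ?_ .rfl
      filter_upwards [N₁.eventually_base hz] with p hp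
      rw [hp]
      have : p - (p.1, 0) = (0, p.2) := by ext <;> simp
      simp [normalTrans, tangentTrans, this]
    have h2 : OrdAt 2 z fun p => (Φ.1.toFun k j p).2 - (N₁.toFun k j p).2 :=
      OrdAt.snd (Φ.2 k j z hz)
    refine (h2.add h1).congr_left fun p => ?_
    abel

theorem Moduli.ordAt_homog_comp (Φ : Moduli N₁) (hz : z ∈ 𝒰.overlap k j) {A : Set (Fin n → ℂ)}
    (hA : IsOpen A) (hzA : 𝒰.trans k j z ∈ A) {u : Coord n d → Coord n d}
    (hu : u ∈ Homog n d l A) (hl : 1 ≤ l) :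
    OrdAt (l + 1) z fun p => u (Φ.1.toFun k j p) - u (normalTrans N₁ k j p) :=
  OrdAt.homogeneous_comp_sub_comp (Homog.analyticAt hu hzA) hl (Homog.eventually_smul hu hA hzA)
    (Φ.1.adaptedAt hz) (Φ.ordAt_sub_normalTrans hz).1 (Φ.ordAt_sub_normalTrans hz).2

theorem IsTangent.ordAt_homog_comp {G : ι → Coord n d → Coord n d} (hG : IsTangent 𝒰 G)
    (hz : z ∈ 𝒰.dom j) {A : Set (Fin n → ℂ)} (hA : IsOpen A) (hzA : z ∈ A)
    {u : Coord n d → Coord n d} (hu : u ∈ Homog n d l A) (hl : 1 ≤ l) :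
    OrdAt (l + 1) z fun p => u (G j p) - u p :=
  OrdAt.homogeneous_comp_sub_comp (B := fun p => p) (Homog.analyticAt hu hzA) hl
    (Homog.eventually_smul hu hA hzA) (hG.adaptedAt hz)
    (OrdAt.mono (OrdAt.fst (hG.tangent j z hz)) one_le_two)
    (OrdAt.snd (hG.tangent j z hz))

/-- The transition functions act on perturbations of order `l` by `g_kj`, modulo `O(l + 1)`. -/
theorem Moduli.ordAt_comp_sub_comp (Ψ : Moduli N₁) {x : Fin n → ℂ} (hx : x ∈ 𝒰.overlap k j)
    {A B v : Coord n d → Coord n d} {b : Coord n d → Fin n → ℂ}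
    (hb : Filter.Tendsto b (𝓝 (z, 0)) (𝓝 x))
    (hA : OrdAt 1 z fun p => A p - (b p, 0)) (hB : OrdAt 1 z fun p => B p - (b p, 0))
    (hAB : OrdAt l z fun p => A p - B p) (hv : OrdAt (l + 1) z fun p => A p - B p - v p) :
    OrdAt (l + 1) z fun p =>
      Ψ.1.toFun k j (A p) - Ψ.1.toFun k j (B p) - tangentTrans N₁ k j (b p) (v p) := by
  have hb0 : Filter.Tendsto (fun p => ((b p, 0) : Coord n d)) (𝓝 (z, 0)) (𝓝 (x, 0)) :=
    hb.prodMk_nhds tendsto_const_nhds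
  have h1 := OrdAt.comp_sub_comp_sub_fderiv (Ψ.1.analyticAt hx) hb0 hA hB hAB
  have hL : Filter.Tendsto (fun p => fderiv ℂ (Ψ.1.toFun k j) (b p, 0)) (𝓝 (z, 0))
      (𝓝 (fderiv ℂ (Ψ.1.toFun k j) (x, 0))) :=
    (Ψ.1.analyticAt hx).fderiv.continuousAt.tendsto.comp hb0
  have h2 : OrdAt (l + 1) z
      fun p => fderiv ℂ (Ψ.1.toFun k j) (b p, 0) (A p - B p - v p) := by
    have h3 : (fun p => fderiv ℂ (Ψ.1.toFun k j) (b p, 0) (A p - B p - v p)) =O[𝓝 (z, 0)]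
        fun p => ‖fderiv ℂ (Ψ.1.toFun k j) (b p, 0)‖ * ‖A p - B p - v p‖ :=
      IsBigO.of_bound 1 (.of_forall fun p => by
        rw [one_mul, norm_mul, norm_norm, norm_norm]
        exact ContinuousLinearMap.le_opNorm _ _)
    refine h3.trans ?_
    have := (hL.isBigO_one ℝ).norm_left.mul hv.norm_left
    simpa using this
  refine (h1.add h2).congr' ?_ .rfl
  filter_upwards [hb.eventually ((𝒰.isOpen_overlap k j).mem_nhds hx)] with p hp
  rw [← Ψ.fderiv_eq hp]
  simp only [map_sub]
  abel

theorem normalTrans_smul (k j : ι) (z : Fin n → ℂ) (c : ℂ) (w : Fin d → ℂ) :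
    normalTrans N₁ k j (z, c • w) =
      ((normalTrans N₁ k j (z, w)).1, c • (normalTrans N₁ k j (z, w)).2) := by
  have : ((0, c • w) : Coord n d) = c • (0, w) := by simp
  simp [normalTrans, this, -Prod.smul_mk]

/-- The difference of two neighborhoods that agree to order `l` is, to leading order, a
cocycle. -/
theorem Moduli.exists_cocycle (Φ Ψ : Moduli N₁) (hl : 2 ≤ l)
    (h : ∀ k j, ∀ z ∈ 𝒰.overlap k j, OrdAt l z fun p => Φ.1.toFun k j p - Ψ.1.toFun k j p) :
    ∃ u ∈ Z1 N₁ l, ∀ k j, ∀ z ∈ 𝒰.overlap k j, OrdAt (l + 1) z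
      fun p => Φ.1.toFun k j p - Ψ.1.toFun k j p - u k j p := by
  have han : ∀ k j, AnalyticOnNhd ℂ (fun p => Φ.1.toFun k j p - Ψ.1.toFun k j p)
      (𝒰.overlap k j ×ˢ {0}) := fun k j => (Φ.1.analytic k j).sub (Ψ.1.analytic k j)
  set u : ι → ι → Coord n d → Coord n d := fun k j =>
    homogPart (𝒰.overlap k j) l fun p => Φ.1.toFun k j p - Ψ.1.toFun k j p with hu
  have hmem : u ∈ cochain1 𝒰 d l := fun k j => homogPart_mem (𝒰.isOpen_overlap k j) l (han k j)
  have hlead : ∀ k j, ∀ z ∈ 𝒰.overlap k j, OrdAt (l + 1) z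
      fun p => Φ.1.toFun k j p - Ψ.1.toFun k j p - u k j p := fun k j z hz =>
    ordAt_sub_homogPart (𝒰.isOpen_overlap k j) (han k j) (h k j) hz
  refine ⟨u, ⟨hmem, fun k j i z hz w => ?_⟩, hlead⟩
  have hkj := 𝒰.trans_mem_overlap hz
  -- `Φ_kj Φ_ji - Ψ_kj Ψ_ji = (Φ_kj - Ψ_kj) Φ_ji + (Ψ_kj Φ_ji - Ψ_kj Ψ_ji)`
  have h1 := OrdAt.comp (hlead k j _ hkj) (Φ.1.adaptedAt hz.2)
  have h2 := Φ.ordAt_homog_comp hz.2 (𝒰.isOpen_overlap k j) hkj (hmem k j) (by omega)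
  have h3 := Ψ.ordAt_comp_sub_comp hkj ((𝒰.tendsto_trans hz.2).comp (tendsto_fst_zero z))
    (Φ.1.ordAt_sub_base hz.2) (Ψ.1.ordAt_sub_base hz.2) (h j i z hz.2) (hlead j i z hz.2)
  have h4 := ((h1.add h2).add h3).sub (hlead k i z hz.1)
  have h5 : OrdAt (l + 1) z fun p => u k i p -
      (tangentTrans N₁ k j (𝒰.trans j i p.1) (u j i p) + u k j (normalTrans N₁ j i p)) := by
    refine h4.congr' ?_ .rfl
    filter_upwards [Φ.1.cocycle k j i z hz, Ψ.1.cocycle k j i z hz] with p hp hp'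
    rw [← hp, ← hp']
    simp only [Function.comp]
    abel
  refine sub_eq_zero.1 (OrdAt.eq_zero_of_homogeneous (l := l) (fun c w => ?_) h5 w)
  rw [normalTrans_smul, (hmem k i).2.1 z hz.1, (hmem j i).2.1 z hz.2]
  simp only
  have hN : (normalTrans N₁ j i (z, w)).1 ∈ 𝒰.overlap k j := hkj
  rw [(hmem k j).2.1 _ hN, map_smul, smul_sub, smul_add]

/-- Adding a homogeneous term `f` to the conjugating germs changes the defect `GΦ - ΨG` by
`-δf`, to leading order. -/
theorem IsTangent.ordAt_defect_add {G : ι → Coord n d → Coord n d} (hG : IsTangent 𝒰 G)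
    (Φ Ψ : Moduli N₁) (hl : 2 ≤ l) {f : ι → Coord n d → Coord n d} (hf : f ∈ cochain0 𝒰 d l)
    (hz : z ∈ 𝒰.overlap k j) :
    OrdAt (l + 1) z fun p =>
      (G k (Φ.1.toFun k j p) + f k (Φ.1.toFun k j p) - Ψ.1.toFun k j (G j p + f j p)) -
        (G k (Φ.1.toFun k j p) - Ψ.1.toFun k j (G j p) - delta N₁ f k j p) := by
  have hfO := Homog.ordAt (hf j) (𝒰.isOpen_dom j) hz.1
  have hGb : OrdAt 1 z fun p => G j p - (p.1, 0) := by
    refine ((OrdAt.mono (hG.tangent j z hz.1) one_le_two).add (ordAt_sub_fst z)).congr_left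
      fun p => ?_
    abel
  have h1 := Φ.ordAt_homog_comp hz (𝒰.isOpen_dom k) (𝒰.trans_mem_dom hz) (hf k) (by omega)
  have h2 := Ψ.ordAt_comp_sub_comp (A := fun p => G j p + f j p) (B := G j) (v := f j) hz
    (tendsto_fst_zero z) ?_ hGb ?_ ?_ (l := l)
  · refine (h1.sub h2).congr_left fun p => ?_
    simp only [delta]
    abel
  · refine (hGb.add (OrdAt.mono hfO (by omega))).congr_left fun p => ?_
    abel
  · refine hfO.congr_left fun p => ?_
    abel
  · exact ordAt_of_eventuallyEq_zero (.of_forall fun p => by simp)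

theorem delta_smul_apply {f : ι → Coord n d → Coord n d} (hf : f ∈ cochain0 𝒰 d l)
    (hz : z ∈ 𝒰.overlap k j) (c : ℂ) (w : Fin d → ℂ) :
    delta N₁ f k j (z, c • w) = c ^ l • delta N₁ f k j (z, w) := by
  have hN : (normalTrans N₁ k j (z, w)).1 ∈ 𝒰.dom k := 𝒰.trans_mem_dom hz
  simp only [delta]
  rw [normalTrans_smul, (hf j).2.1 z hz.1, (hf k).2.1 _ hN, map_smul, smul_sub]

/-- The defect of a conjugacy modulo `O(m + 1)` is a cocycle in degree `m + 1`. -/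
theorem exists_cocycle_of_germConj {Φ Ψ : Moduli N₁} (hm : 1 ≤ m) {G : ι → Coord n d → Coord n d}
    (hG : IsTangent 𝒰 G) (h : GermConj m G Φ.1 Ψ.1) :
    ∃ u ∈ Z1 N₁ (m + 1), ∀ k j, ∀ z ∈ 𝒰.overlap k j, OrdAt (m + 2) z
      fun p => G k (Φ.1.toFun k j p) - Ψ.1.toFun k j (G j p) - u k j p := by
  obtain ⟨X, hX⟩ := Φ.exists_conj hG
  obtain ⟨H, hH, hinv⟩ := hG.exists_inverse
  obtain ⟨u, hu, hlead⟩ := X.exists_cocycle Ψ (l := m + 1) (by omega) (fun k j z hz => by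
    refine (OrdAt.comp (h k j z hz) (hH.adaptedAt hz.1)).congr' ?_ .rfl
    filter_upwards [(hinv j z hz.1).2, (hH.adaptedAt hz.1).tendsto.eventually (hX k j z hz)]
      with p h1 h2
    rw [← h2, h1])
  refine ⟨u, hu, fun k j z hz => ?_⟩
  have h1 := OrdAt.comp (hlead k j z hz) (hG.adaptedAt hz.1)
  have h2 := hG.ordAt_homog_comp hz.1 (𝒰.isOpen_overlap k j) hz (hu.1 k j) (by omega)
  refine (h1.add h2).congr' ?_ .rfl
  filter_upwards [hX k j z hz] with p hp
  rw [hp]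
  abel

theorem FormalMap.conjMod_of_succ {F : FormalMap 𝒰 d} {Φ Ψ : Neighborhood 𝒰 d}
    (h : ConjMod (m + 1) F Φ.toFun Ψ.toFun) : ConjMod m F Φ.toFun Ψ.toFun := by
  refine (GermConj.mono h (Nat.le_succ m)).of_congr (F.isTangent_trunc _) (F.isTangent_trunc _)
    fun j z hz => ?_
  simpa [F.trunc_succ] using
    (Homog.ordAt (F.term_mem (m + 1) j) (𝒰.isOpen_dom j) hz).neg_left

theorem FormalMap.conjMod_of_succ_of_ordAt {F : FormalMap 𝒰 d} {Φ Ψ X : Neighborhood 𝒰 d}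
    (h : ConjMod (m + 1) F Φ.toFun Ψ.toFun) (hX : ∀ k j, ∀ z ∈ 𝒰.overlap k j,
      OrdAt (m + 1) z fun p => Ψ.toFun k j p - X.toFun k j p) :
    ConjMod m F Φ.toFun X.toFun := by
  have h1 : GermConj m _ Φ Ψ := conjMod_of_succ h
  refine h1.of_congr_target (F.isTangent_trunc m) fun k j z hz => ?_
  refine (hX k j z hz).neg_left.congr_left fun p => ?_
  abel

/-- A conjugacy modulo `O(m + 1)` whose defect is a coboundary extends by one degree. -/
theorem conjMod_extend {Φ Ψ : Moduli N₁} (hm : 1 ≤ m) {F : FormalMap 𝒰 d}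
    {u : ι → ι → Coord n d → Coord n d} {f : ι → Coord n d → Coord n d}
    (hf : f ∈ cochain0 𝒰 d (m + 1))
    (hu : ∀ k j, ∀ z ∈ 𝒰.overlap k j, OrdAt (m + 2) z fun p =>
      F.trunc m k (Φ.1.toFun k j p) - Ψ.1.toFun k j (F.trunc m j p) - u k j p)
    (huf : ∀ k j, ∀ z ∈ 𝒰.overlap k j, ∀ w, u k j (z, w) = delta N₁ f k j (z, w)) :
    ConjMod (m + 1) (F.extend hm hf) Φ.1.toFun Ψ.1.toFun := by
  intro k j z hz
  simp only [FormalMap.trunc_extend]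
  have h1 := (F.isTangent_trunc m).ordAt_defect_add Φ Ψ (l := m + 1) (by omega) hf hz
  refine (h1.add (hu k j z hz)).congr' ?_ .rfl
  have hO : ∀ᶠ p in 𝓝 ((z, 0) : Coord n d), p.1 ∈ 𝒰.overlap k j :=
    (tendsto_fst_zero z).eventually ((𝒰.isOpen_overlap k j).mem_nhds hz)
  filter_upwards [hO] with p hp
  rw [huf k j p.1 hp p.2]
  abel

/-- If there are no global sections in degrees `≥ 2`, a conjugacy modulo `O(m + 1)` is unique
modulo `O(m + 1)`. -/
theorem FormalMap.term_eq_of_conjMod (h0 : ∀ l, 2 ≤ l → ∀ f ∈ H0 N₁ l, f = 0)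
    {Φ Ψ : Moduli N₁} {F G : FormalMap 𝒰 d} (m : ℕ) (hF : ConjMod m F Φ.1.toFun Ψ.1.toFun)
    (hG : ConjMod m G Φ.1.toFun Ψ.1.toFun) : ∀ l ≤ m, F.term l = G.term l := by
  induction m with
  | zero =>
    intro l hl
    obtain rfl : l = 0 := by omega
    rw [F.term_zero, G.term_zero]
  | succ m ih =>
    have hlow := ih (conjMod_of_succ hF) (conjMod_of_succ hG)
    intro l hl
    rcases Nat.lt_or_ge l (m + 1) with h1 | h1
    · exact hlow l (by omega)
    obtain rfl : l = m + 1 := by omega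
    rcases Nat.eq_zero_or_pos m with rfl | hm
    · rw [F.term_one, G.term_one]
    have htr : ∀ j p, G.trunc m j p = F.trunc m j p := by
      intro j p
      simp only [trunc]
      congr 1
      refine Finset.sum_congr rfl fun l hl => ?_
      rw [hlow l (Nat.lt_succ_iff.1 (Finset.mem_range.1 hl))]
    refine sub_eq_zero.1 (h0 (m + 1) (by omega) _
      ⟨sub_mem (F.term_mem _) (G.term_mem _), fun k j z hz w => ?_⟩)
    refine OrdAt.eq_zero_of_homogeneous (l := m + 1)
      (fun c w => delta_smul_apply (sub_mem (F.term_mem _) (G.term_mem _)) hz c w) ?_ w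
    have h1 := ((F.isTangent_trunc m).ordAt_defect_add Φ Ψ (l := m + 1) (by omega)
      (F.term_mem _) hz).sub (hF k j z hz)
    have h2 := ((F.isTangent_trunc m).ordAt_defect_add Φ Ψ (l := m + 1) (by omega)
      (G.term_mem _) hz).sub (hG k j z hz)
    refine (h1.sub h2).congr_left fun p => ?_
    have hδ : delta N₁ (F.term (m + 1) - G.term (m + 1)) k j p =
        delta N₁ (F.term (m + 1)) k j p - delta N₁ (G.term (m + 1)) k j p := by
      rw [sub_eq_add_neg, ← neg_one_smul ℂ, delta_add, delta_smul, neg_one_smul, sub_eq_add_neg]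
    rw [hδ]
    simp only [trunc_succ, htr]
    abel

end FormalNbhd

/-! ### Representatives and partial normal forms -/

namespace FormalNbhd

universe u v w

variable {n d : ℕ} {C : Type u} [TopologicalSpace C] [ChartedSpace (Fin n → ℂ) C] {ι : Type v}
  {𝒰 : PolydiscCover n C ι} {N₁ : Neighborhood 𝒰 d} {B : CocycleBasis.{u, v, w} N₁} {m : ℕ}

theorem CocycleBasis.mk_dot (B : CocycleBasis.{u, v, w} N₁) (l : ℕ) (c : H1 N₁ l) :
    H1.mk N₁ l (B.dot l c) = c := by
  have h : H1.mk N₁ l ∘ₗ B.dot l = LinearMap.id := by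
    refine (B.basis l).ext fun i => ?_
    rw [LinearMap.comp_apply, CocycleBasis.dot, Module.Basis.constr_basis, B.mk_e]
    rfl
  exact LinearMap.congr_fun h c

theorem exists_delta_of_mk_eq {l : ℕ} {u u' : Z1 N₁ l} (h : H1.mk N₁ l u = H1.mk N₁ l u') :
    ∃ f ∈ cochain0 𝒰 d l, ∀ k j, ∀ z ∈ 𝒰.overlap k j, ∀ w,
      u.1 k j (z, w) - u'.1 k j (z, w) = delta N₁ f k j (z, w) := by
  have h1 : u - u' ∈ (B1 N₁ l).submoduleOf (Z1 N₁ l) := (Submodule.Quotient.eq _).1 h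
  obtain ⟨-, f, hf, hfu⟩ := h1
  exact ⟨f, hf, hfu⟩

theorem CocycleBasis.dot_mem (B : CocycleBasis.{u, v, w} N₁) (l : ℕ) (c : H1 N₁ l) (k j : ι) :
    (B.dot l c).1 k j ∈ Homog n d l (𝒰.overlap k j) := (B.dot l c).2.1 k j

theorem IsShift.ordAt_sub {Φ Ψ : Moduli N₁} {c : H1 N₁ m} (h : IsShift B m Φ Ψ c) {k j : ι}
    {z : Fin n → ℂ} (hz : z ∈ 𝒰.overlap k j) :
    OrdAt m z fun p => Ψ.1.toFun k j p - Φ.1.toFun k j p := by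
  have h1 := Homog.ordAt (B.dot_mem m c k j) (𝒰.isOpen_overlap k j) hz
  refine ((OrdAt.mono (h k j z hz) (Nat.le_succ m)).add h1).congr_left fun p => ?_
  abel

theorem IsShift.class_unique {Φ Ψ : Moduli N₁} {c c' : H1 N₁ m} (h : IsShift B m Φ Ψ c)
    (h' : IsShift B m Φ Ψ c') : c = c' := by
  have h0 : B.dot m c = B.dot m c' := by
    refine Subtype.ext (funext fun k => funext fun j => sub_eq_zero.1 ?_)
    refine Homog.eq_zero (sub_mem (B.dot_mem m c k j) (B.dot_mem m c' k j)) fun z hz => ?_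
    refine (IsBigO.sub (h' k j z hz) (h k j z hz)).congr_left fun p => ?_
    simp only [Pi.sub_apply]
    abel
  rw [← B.mk_dot m c, h0, B.mk_dot]

theorem isShift_self (B : CocycleBasis.{u, v, w} N₁) (m : ℕ) (Φ : Moduli N₁) :
    IsShift B m Φ Φ 0 := fun k j z _ =>
  ordAt_of_eventuallyEq_zero (.of_forall fun p => by simp)

/-- Two elements of `𝓜_m(Φ)` conjugate modulo `O(m + 1)` are conjugate by an element of
`Aut_{m-1}(Φ)`: both agree with `Φ` modulo `O(m)`. -/
theorem autRel_iff (hm : 1 ≤ m) {Φ Ψ Ψ' : Moduli N₁} (hΨ : Ψ ∈ ModuliMod B m Φ)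
    (hΨ' : Ψ' ∈ ModuliMod B m Φ) : AutRel m Φ Ψ Ψ' ↔ EquivMod m Ψ Ψ' := by
  refine ⟨fun ⟨F, _, hF⟩ => ⟨F, hF⟩, fun ⟨F, hF⟩ => ⟨F, ?_, hF⟩⟩
  obtain ⟨m, rfl⟩ : ∃ k, m = k + 1 := ⟨m - 1, by omega⟩
  obtain ⟨c, hc⟩ := hΨ
  obtain ⟨c', hc'⟩ := hΨ'
  have h1 : GermConj m (F.trunc m) Ψ.1 Ψ'.1 := FormalMap.conjMod_of_succ hF
  have h2 := h1.of_congr_target (F.isTangent_trunc m) (X := Φ.1) fun k j z hz => by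
    refine (IsShift.ordAt_sub hc' hz).neg_left.congr_left fun p => ?_
    abel
  exact h2.of_congr_source (F.isTangent_trunc m) fun k j z hz => by
    refine (IsShift.ordAt_sub hc hz).neg_left.congr_left fun p => ?_
    abel

theorem nonempty_representatives (B : CocycleBasis.{u, v, w} N₁) :
    Nonempty (Representatives B) := by
  classical
  let s (m : ℕ) (Φ : Moduli N₁) : Setoid (ModuliMod B m Φ) :=
    ⟨fun a b => EquivMod m a.1 b.1, fun a => .refl m a.1, fun h => h.symm, fun h h' => h.trans h'⟩
  let self (m : ℕ) (Φ : Moduli N₁) : ModuliMod B m Φ := ⟨Φ, 0, isShift_self B m Φ⟩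
  let σ (m : ℕ) (Φ : Moduli N₁) (q : Quotient (s m Φ)) : ModuliMod B m Φ :=
    if q = Quotient.mk _ (self m Φ) then self m Φ else q.out
  have hσ : ∀ m Φ q, Quotient.mk _ (σ m Φ q) = q := by
    intro m Φ q
    simp only [σ]
    split_ifs with h
    · exact h.symm
    · exact q.out_eq
  refine ⟨⟨fun m Φ => Set.range fun q => (σ m Φ q).1, ?_, ?_, ?_⟩⟩
  · rintro m - Φ _ ⟨q, rfl⟩
    exact (σ m Φ q).2
  · intro m hm Φ Ψ hΨ
    refine ⟨(σ m Φ (Quotient.mk _ ⟨Ψ, hΨ⟩)).1, ⟨⟨_, rfl⟩, ?_⟩, ?_⟩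
    · rw [autRel_iff (by omega) hΨ (σ m Φ _).2]
      exact (Quotient.exact (hσ m Φ (Quotient.mk _ ⟨Ψ, hΨ⟩))).symm
    · rintro _ ⟨⟨q, rfl⟩, hq⟩
      rw [autRel_iff (by omega) hΨ (σ m Φ _).2] at hq
      have h1 : (Quotient.mk _ ⟨Ψ, hΨ⟩ : Quotient (s m Φ)) = Quotient.mk _ (σ m Φ q) :=
        Quotient.sound hq
      simp only
      rw [h1, hσ]
  · intro m _ Φ
    exact ⟨Quotient.mk _ (self m Φ), by simp [σ, self]⟩

/-- Inductive step of the normalization: if `Φ` is conjugate to `Ψ` modulo `O(m + 1)`, a further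
conjugation replaces the cocycle of the defect by the chosen representative of its class. -/
theorem exists_moduliMod_equivMod (B : CocycleBasis.{u, v, w} N₁) (hm : 1 ≤ m) {Φ Ψ : Moduli N₁}
    (h : EquivMod m Φ Ψ) : ∃ X ∈ ModuliMod B (m + 1) Ψ, EquivMod (m + 1) Φ X := by
  obtain ⟨F, hF⟩ := h
  obtain ⟨u, hu, hlead⟩ := exists_cocycle_of_germConj hm (F.isTangent_trunc m) hF
  set c := H1.mk N₁ (m + 1) ⟨u, hu⟩ with hc
  obtain ⟨f, hf, hfu⟩ := exists_delta_of_mk_eq (u := ⟨u, hu⟩) (u' := B.dot (m + 1) c)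
    (B.mk_dot (m + 1) c).symm
  have hG := (F.isTangent_trunc m).add_homog hf (by omega)
  obtain ⟨X, hX⟩ := Φ.exists_conj hG
  obtain ⟨H, hH, hinv⟩ := hG.exists_inverse
  refine ⟨X, ⟨c, fun k j z hz => ?_⟩, .of_germConj hG fun k j z hz => ?_⟩
  · have hO : ∀ᶠ p in 𝓝 ((z, 0) : Coord n d), p.1 ∈ 𝒰.overlap k j :=
      (tendsto_fst_zero z).eventually ((𝒰.isOpen_overlap k j).mem_nhds hz)
    have h1 : OrdAt (m + 2) z fun p => X.1.toFun k j (F.trunc m j p + f j p) -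
        Ψ.1.toFun k j (F.trunc m j p + f j p) - (B.dot (m + 1) c).1 k j p := by
      refine (((F.isTangent_trunc m).ordAt_defect_add Φ Ψ (l := m + 1) (by omega) hf hz).add
        (hlead k j z hz)).congr' ?_ .rfl
      filter_upwards [hO, hX k j z hz] with p hp hXp
      have := hfu k j p.1 hp p.2
      rw [hXp, ← this]
      abel
    have h2 := OrdAt.comp h1 (hH.adaptedAt hz.1)
    have h3 := hH.ordAt_homog_comp hz.1 (𝒰.isOpen_overlap k j) hz (B.dot_mem (m + 1) c k j)
      (by omega)
    refine (h2.add h3).congr' ?_ .rfl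
    filter_upwards [(hinv j z hz.1).2] with p hp
    rw [hp]
    abel
  · refine ordAt_of_eventuallyEq_zero ?_
    filter_upwards [hX k j z hz] with p hp
    rw [hp, sub_self]
    rfl

theorem Representatives.exists_reps_equivMod (R : Representatives B) (hm : 1 ≤ m) {Φ Ψ : Moduli N₁}
    (h : EquivMod m Φ Ψ) : ∃ X ∈ R.reps (m + 1) Ψ, EquivMod (m + 1) Φ X := by
  obtain ⟨Y, hY, hΦY⟩ := exists_moduliMod_equivMod B hm h
  obtain ⟨X, ⟨hX, hYX⟩, -⟩ := R.existsUnique (m + 1) (by omega) Ψ Y hY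
  exact ⟨X, hX, hΦY.trans
    ((autRel_iff (by omega) hY (R.reps_subset _ (by omega) _ hX)).1 hYX)⟩

theorem Representatives.eq_of_equivMod (R : Representatives B) (hm : 2 ≤ m) {Φ X Y : Moduli N₁}
    (hX : X ∈ R.reps m Φ) (hY : Y ∈ R.reps m Φ) (h : EquivMod m X Y) : X = Y := by
  have hX' := R.reps_subset m hm Φ hX
  have hY' := R.reps_subset m hm Φ hY
  exact (R.existsUnique m hm Φ X hX').unique
    ⟨hX, (autRel_iff (by omega) hX' hX').2 (.refl m X)⟩
    ⟨hY, (autRel_iff (by omega) hX' hY').2 h⟩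

namespace IsPartialNormalForms

variable {R : Representatives B} {c c' : CalH1Hat N₁} {N N' : ℕ → Moduli N₁}

theorem ordAt_sub (h : IsPartialNormalForms R c N) (hm : 1 ≤ m) {k j : ι} {z : Fin n → ℂ}
    (hz : z ∈ 𝒰.overlap k j) :
    OrdAt (m + 1) z fun p => (N (m + 1)).1.toFun k j p - (N m).1.toFun k j p :=
  IsShift.ordAt_sub (h.2 m hm).2 hz

theorem class_eq (h : IsPartialNormalForms R c N) (h' : IsPartialNormalForms R c' N')
    (hN : ∀ m, 1 ≤ m → N m = N' m) : c = c' := by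
  funext ⟨l, hl⟩
  obtain ⟨m, rfl⟩ : ∃ k, l = k + 1 := ⟨l - 1, by omega⟩
  have h1 := (h'.2 m (by omega)).2
  rw [← hN m (by omega), ← hN (m + 1) (by omega)] at h1
  exact IsShift.class_unique (h.2 m (by omega)).2 h1

/-- Partial normal forms are determined by the classes: representatives with the same class
agree modulo `O(m + 1)`, hence lie in the same equivalence class. -/
theorem eq_of_class_eq (h : IsPartialNormalForms R c N) (h' : IsPartialNormalForms R c N')
    (hm : 1 ≤ m) : N m = N' m := by
  induction m, hm using Nat.le_induction with
  | base => rw [h.1, h'.1]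
  | succ m hm ih =>
    obtain ⟨h1, h2⟩ := h.2 m hm
    obtain ⟨h3, h4⟩ := h'.2 m hm
    rw [← ih] at h3 h4
    refine R.eq_of_equivMod (by omega) h1 h3 (.of_ordAt fun k j z hz => ?_)
    refine (IsBigO.sub (h4 k j z hz) (h2 k j z hz)).congr_left fun p => ?_
    abel

theorem eq_of_equivMod (h : IsPartialNormalForms R c N) (h' : IsPartialNormalForms R c' N')
    {Φ : Moduli N₁} (hΦ : ∀ m, 1 ≤ m → EquivMod m Φ (N m))
    (hΦ' : ∀ m, 1 ≤ m → EquivMod m Φ (N' m)) (hm : 1 ≤ m) : N m = N' m := by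
  induction m, hm using Nat.le_induction with
  | base => rw [h.1, h'.1]
  | succ m hm ih =>
    have h1 := (h.2 m hm).1
    have h3 := (h'.2 m hm).1
    rw [← ih] at h3
    exact R.eq_of_equivMod (by omega) h1 h3 ((hΦ _ (by omega)).symm.trans (hΦ' _ (by omega)))

theorem exists_isLimit (h : IsPartialNormalForms R c N) : ∃ P : FormalTransition 𝒰 d,
    IsLimit P N := by
  -- `N 0` is irrelevant and is replaced by `N 1`
  refine ⟨⟨fun l k j => homogPart (𝒰.overlap k j) l ((N (max l 1)).1.toFun k j), fun l k j =>
    homogPart_mem (𝒰.isOpen_overlap k j) l ((N (max l 1)).1.analytic k j)⟩,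
    fun m hm k j z hz => ?_⟩
  have h1 := ordAt_sum_homogPart_sub (𝒰.isOpen_overlap k j)
    (g := fun l => (N (max l 1)).1.toFun k j) (fun m => (N (max m 1)).1.analytic k j)
    (fun m z hz => by
      rcases Nat.eq_zero_or_pos m with rfl | hm
      · exact ordAt_of_eventuallyEq_zero (.of_forall fun p => by simp)
      · rw [max_eq_left (show 1 ≤ m + 1 by omega), max_eq_left (show 1 ≤ m by omega)]
        exact h.ordAt_sub hm hz) m hz
  simp only [max_eq_left hm] at h1
  exact h1

end IsPartialNormalForms

theorem IsLimit.unique {P P' : FormalTransition 𝒰 d} {N N' : ℕ → Moduli N₁} (h : IsLimit P N)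
    (h' : IsLimit P' N') (hN : ∀ m, 1 ≤ m → N m = N' m) : P = P' := by
  have hterm : P.term = P'.term := by
    funext l k j
    refine sub_eq_zero.1 (Homog.eq_zero_of_sum (𝒰.isOpen_overlap k j)
      (u := fun l => P.term l k j - P'.term l k j)
      (fun l => sub_mem (P.term_mem l k j) (P'.term_mem l k j)) (l + 1) (fun z hz => ?_) l
      (Nat.le_succ l))
    have h1 := h' (l + 1) (by omega) k j z hz
    rw [← hN _ (by omega)] at h1
    refine (IsBigO.sub (h (l + 1) (by omega) k j z hz) h1).congr_left fun p => ?_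
    simp only [FormalTransition.trunc, Pi.sub_apply, Finset.sum_sub_distrib]
    abel
  cases P
  cases P'
  cases hterm
  rfl

theorem Representatives.exists_isNormalFormOf (R : Representatives B) (Φ : Moduli N₁) :
    ∃ c P, IsNormalFormOf R Φ c P := by
  have h1 : EquivMod 1 Φ (Moduli.base N₁) := .of_germConj .id fun _ _ _ hz =>
    IsTangent.id.ordAt_conj Φ _ hz
  have : Nonempty (Moduli N₁) := ⟨Φ⟩
  choose! next hnext using fun (m : ℕ) (hm : 1 ≤ m) (Ψ : Moduli N₁) (h : EquivMod m Φ Ψ) =>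
    R.exists_reps_equivMod hm h
  let N : ℕ → Moduli N₁ := fun m => Nat.rec (Moduli.base N₁)
    (fun m Ψ => if m = 0 then Moduli.base N₁ else next m Ψ) m
  have hN1 : N 1 = Moduli.base N₁ := rfl
  have hNs : ∀ m, 1 ≤ m → N (m + 1) = next m (N m) := fun m hm => if_neg (by omega)
  have hN : ∀ m, 1 ≤ m → EquivMod m Φ (N m) := by
    intro m hm
    induction m, hm using Nat.le_induction with
    | base => exact h1
    | succ m hm ih =>
      rw [hNs m hm]
      exact (hnext m hm _ ih).2
  have hrep : ∀ m, 1 ≤ m → N (m + 1) ∈ R.reps (m + 1) (N m) := by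
    intro m hm
    rw [hNs m hm]
    exact (hnext m hm _ (hN m hm)).1
  choose! c hc using fun (m : ℕ) (hm : 1 ≤ m) =>
    R.reps_subset (m + 1) (by omega) (N m) (hrep m hm)
  have hpart : ∃ c : CalH1Hat N₁, IsPartialNormalForms R c N := by
    refine ⟨fun l => match l with
      | ⟨0, h⟩ => 0
      | ⟨m + 1, _⟩ => c m, hN1, fun m hm => ⟨hrep m hm, hc m hm⟩⟩
  obtain ⟨c, hc⟩ := hpart
  obtain ⟨P, hP⟩ := hc.exists_isLimit
  exact ⟨c, P, N, hc, hP, hN⟩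

theorem IsNormalFormOf.unique {R : Representatives B} {Φ Ψ : Moduli N₁} {c c' : CalH1Hat N₁}
    {P P' : FormalTransition 𝒰 d} (h : IsNormalFormOf R Φ c P) (h' : IsNormalFormOf R Ψ c' P')
    (hΦΨ : ∀ m, EquivMod m Φ Ψ) : c = c' ∧ P = P' := by
  obtain ⟨N, hN, hP, hΦ⟩ := h
  obtain ⟨N', hN', hP', hΨ⟩ := h'
  have hNN : ∀ m, 1 ≤ m → N m = N' m := fun m hm =>
    hN.eq_of_equivMod hN' hΦ (fun m hm => (hΦΨ m).trans (hΨ m hm)) hm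
  exact ⟨hN.class_eq hN' hNN, hP.unique hP' hNN⟩

/-! ### Formal convergence of the normalization -/

/-- In the absence of global sections the normalizing mappings are coherent. -/
theorem exists_conjMod_of_H0 (h0 : ∀ l, 2 ≤ l → ∀ f ∈ H0 N₁ l, f = 0) {Φ : Moduli N₁}
    {N : ℕ → Moduli N₁} (hN : ∀ m, 1 ≤ m → ∀ k j, ∀ z ∈ 𝒰.overlap k j,
      OrdAt (m + 1) z fun p => (N (m + 1)).1.toFun k j p - (N m).1.toFun k j p)
    (hΦ : ∀ m, 1 ≤ m → EquivMod m Φ (N m)) :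
    ∃ F : FormalMap 𝒰 d, ∀ m, ConjMod m F Φ.1.toFun (N m).1.toFun := by
  have : Nonempty (FormalMap 𝒰 d) := ⟨(hΦ 1 le_rfl).choose⟩
  choose! F hF using hΦ
  have hsucc : ∀ m, 1 ≤ m → ∀ l ≤ m, (F (m + 1)).term l = (F m).term l := by
    intro m hm
    exact FormalMap.term_eq_of_conjMod h0 m
      (FormalMap.conjMod_of_succ_of_ordAt (hF (m + 1) (by omega)) (hN m hm)) (hF m hm)
  have hle : ∀ l, 1 ≤ l → ∀ m, l ≤ m → (F m).term l = (F l).term l := by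
    intro l hl m hm
    induction m, hm using Nat.le_induction with
    | base => rfl
    | succ m hm ih => rw [hsucc m (by omega) l hm, ih]
  refine ⟨⟨fun l => (F l).term l, fun l => (F l).term_mem l, (F 0).term_zero, (F 1).term_one⟩,
    fun m => ?_⟩
  rcases Nat.eq_zero_or_pos m with rfl | hm
  · exact conjMod_of_le_one (by omega) _ _ _
  have htr : FormalMap.trunc ⟨fun l => (F l).term l, fun l => (F l).term_mem l,
      (F 0).term_zero, (F 1).term_one⟩ m = (F m).trunc m := by
    funext j p
    simp only [FormalMap.trunc]
    congr 1
    refine Finset.sum_congr rfl fun l hl => ?_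
    rcases Nat.eq_zero_or_pos l with rfl | hl0
    · rw [(F 0).term_zero, (F m).term_zero]
    · rw [hle l hl0 m (Nat.lt_succ_iff.1 (Finset.mem_range.1 hl))]
  intro k j
  rw [htr]
  exact hF m hm k j

/-- If the obstruction spaces vanish in large degrees, a normalizing mapping of large degree
extends, degree by degree and without changing its lower terms. -/
theorem exists_conjMod_of_H1 {L : ℕ} (hL : 1 ≤ L) (hH1 : ∀ l, L < l → Subsingleton (H1 N₁ l))
    {Φ : Moduli N₁} {N : ℕ → Moduli N₁} (hN : ∀ m, 1 ≤ m → ∀ k j, ∀ z ∈ 𝒰.overlap k j,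
      OrdAt (m + 1) z fun p => (N (m + 1)).1.toFun k j p - (N m).1.toFun k j p)
    (hΦ : EquivMod L Φ (N L)) :
    ∃ F : FormalMap 𝒰 d, ∀ m, ConjMod m F Φ.1.toFun (N m).1.toFun := by
  have hup : ∀ m, L ≤ m → ∀ F : FormalMap 𝒰 d, ConjMod m F Φ.1.toFun (N m).1.toFun →
      ∃ F' : FormalMap 𝒰 d, ConjMod (m + 1) F' Φ.1.toFun (N (m + 1)).1.toFun ∧
        ∀ l ≤ m, F'.term l = F.term l := by
    intro m hm F hF
    have h1 : GermConj m (F.trunc m) Φ.1 (N (m + 1)).1 :=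
      GermConj.of_congr_target hF (F.isTangent_trunc m) (hN m (by omega))
    obtain ⟨u, hu, hlead⟩ := exists_cocycle_of_germConj (by omega) (F.isTangent_trunc m) h1
    have := hH1 (m + 1) (by omega)
    obtain ⟨f, hf, hfu⟩ := exists_delta_of_mk_eq (u := ⟨u, hu⟩) (u' := 0)
      (Subsingleton.elim _ _)
    exact ⟨F.extend (by omega) hf, conjMod_extend (by omega) hf hlead
      fun k j z hz w => by simpa using hfu k j z hz w,
      fun l hl => FormalMap.extend_term_of_le hl⟩
  obtain ⟨F₀, hF₀⟩ := hΦ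
  choose! next hnext using hup
  let F : ℕ → FormalMap 𝒰 d := fun i => Nat.rec F₀ (fun i F => next (L + i) F) i
  have hF : ∀ i, ConjMod (L + i) (F i) Φ.1.toFun (N (L + i)).1.toFun := by
    intro i
    induction i with
    | zero => exact hF₀
    | succ i ih => exact (hnext (L + i) (by omega) _ ih).1
  have hterm : ∀ i l, l ≤ L + i → (F (i + 1)).term l = (F i).term l := fun i =>
    (hnext (L + i) (by omega) _ (hF i)).2
  have hle : ∀ l i, l ≤ L + i → ∀ i', i ≤ i' → (F i').term l = (F i).term l := by
    intro l i hl i' hi'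
    induction i', hi' using Nat.le_induction with
    | base => rfl
    | succ i' hi' ih => rw [hterm i' l (by omega), ih]
  let G : FormalMap 𝒰 d := ⟨fun l => (F l).term l, fun l => (F l).term_mem l,
    (F 0).term_zero, (F 1).term_one⟩
  have hG : ∀ i, ConjMod (L + i) G Φ.1.toFun (N (L + i)).1.toFun := by
    intro i k j
    have htr : G.trunc (L + i) = (F i).trunc (L + i) := by
      funext j p
      simp only [FormalMap.trunc]
      congr 1
      refine Finset.sum_congr rfl fun l hl => ?_
      have hl' := Nat.lt_succ_iff.1 (Finset.mem_range.1 hl)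
      have e : (F l).term l = (F i).term l := by
        rcases le_total l i with h | h
        · exact (hle l l (by omega) i h).symm
        · exact hle l i hl' l h
      exact congrFun (congrFun e j) p
    rw [htr]
    exact hF i k j
  refine ⟨G, fun m => ?_⟩
  rcases Nat.eq_zero_or_pos m with rfl | hm
  · exact conjMod_of_le_one (by omega) _ _ _
  rcases le_total L m with h | h
  · obtain ⟨i, rfl⟩ := Nat.exists_eq_add_of_le h
    exact hG i
  · induction h using Nat.decreasingInduction with
    | self => exact hG 0
    | of_succ i hi ih => exact FormalMap.conjMod_of_succ_of_ordAt (ih (by omega)) (hN i hm)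

theorem IsLimit.transforms {P : FormalTransition 𝒰 d} {N : ℕ → Moduli N₁} (hP : IsLimit P N)
    {Φ : Moduli N₁} {F : FormalMap 𝒰 d} (hF : ∀ m, ConjMod m F Φ.1.toFun (N m).1.toFun) :
    Transforms F Φ P := by
  intro m k j z hz
  have key : OrdAt (m + 1) z
      fun p => P.trunc m k j p - (N (max m 1)).1.toFun k j p := by
    rcases Nat.eq_zero_or_pos m with rfl | hm
    · have h1 := OrdAt.mono (hP 1 le_rfl k j z hz) one_le_two
      refine (h1.sub (Homog.ordAt (P.term_mem 1 k j) (𝒰.isOpen_overlap k j) hz)).congr_left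
        fun p => ?_
      simp [FormalTransition.trunc, Finset.sum_range_succ]
      abel
    · rw [max_eq_left hm]
      exact hP m hm k j z hz
  have hF' : OrdAt (m + 1) z fun p => F.trunc m k (Φ.1.toFun k j p) -
      (N (max m 1)).1.toFun k j (F.trunc m j p) := by
    rcases Nat.eq_zero_or_pos m with rfl | hm
    · exact conjMod_of_le_one (by omega) F Φ _ k j z hz
    · rw [max_eq_left hm]
      exact hF m k j z hz
  refine (hF'.sub (OrdAt.comp key ((F.isTangent_trunc m).adaptedAt hz.1))).congr_left fun p => ?_
  abel

theorem eq_zero_of_subsingleton_calH0 (h : Subsingleton (CalH0 N₁)) (l : ℕ) (hl : 2 ≤ l)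
    (f : ι → Coord n d → Coord n d) (hf : f ∈ H0 N₁ l) : f = 0 := by
  let β : {l : ℕ // 2 ≤ l} → Type v := fun l => H0 N₁ l.1
  let i : {l : ℕ // 2 ≤ l} := ⟨l, hl⟩
  have h1 : (⟨f, hf⟩ : β i) = 0 := DirectSum.of_injective (β := β) i
    (Subsingleton.elim (α := CalH0 N₁) _ _)
  exact congrArg Subtype.val h1

/-- A finite-dimensional direct sum has only finitely many nonzero summands. -/
theorem exists_subsingleton_H1 [FiniteDimensional ℂ (CalH1 N₁)] :
    ∃ L, 1 ≤ L ∧ ∀ l, L < l → Subsingleton (H1 N₁ l) := by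
  classical
  obtain ⟨s, hs⟩ := Module.Finite.fg_top (R := ℂ) (M := CalH1 N₁)
  let T : Finset {l : ℕ // 2 ≤ l} := s.biUnion fun x => DFinsupp.support x
  obtain ⟨L, hL⟩ := (T.image Subtype.val).bddAbove
  have hvan : ∀ x : CalH1 N₁, ∀ l : {l : ℕ // 2 ≤ l}, L < l.1 → x l = 0 := by
    intro x l hl
    have hx : x ∈ Submodule.span ℂ (s : Set (CalH1 N₁)) := hs ▸ Submodule.mem_top
    induction hx using Submodule.span_induction with
    | mem x hx =>
      by_contra hne
      have hT : l ∈ T := Finset.mem_biUnion.2 ⟨x, hx, DFinsupp.mem_support_iff.2 hne⟩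
      have := hL (Finset.mem_coe.2 (Finset.mem_image_of_mem Subtype.val hT))
      omega
    | zero => rfl
    | add x y _ _ hx hy => rw [DirectSum.add_apply, hx, hy, add_zero]
    | smul a x _ hx => rw [DirectSum.smul_apply, hx, smul_zero]
  refine ⟨max L 1, le_max_right _ _, fun l hl => ⟨fun a b => ?_⟩⟩
  have hl1 : L < l := lt_of_le_of_lt (le_max_left _ _) hl
  have hl2 : 2 ≤ l := by have := le_max_right L 1; omega
  have h0 : ∀ a : H1 N₁ l, a = 0 := by
    intro a
    have := hvan (DirectSum.of (fun l : {l : ℕ // 2 ≤ l} => H1 N₁ l.1) ⟨l, hl2⟩ a) ⟨l, hl2⟩ hl1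
    rwa [DirectSum.of_eq_same] at this
  rw [h0 a, h0 b]

theorem exists_calH1_apply_eq [FiniteDimensional ℂ (CalH1 N₁)] (c : CalH1Hat N₁) :
    ∃ x : CalH1 N₁, ∀ l, x l = c l := by
  classical
  obtain ⟨L, -, hL⟩ := exists_subsingleton_H1 (N₁ := N₁)
  refine ⟨DirectSum.mk _ ((Finset.range (L + 1)).subtype _) fun l => c l, fun l => ?_⟩
  by_cases hl : l ∈ (Finset.range (L + 1)).subtype (2 ≤ ·)
  · rw [DirectSum.mk_apply_of_mem hl]
  · have h1 : L < l.1 := by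
      simpa [Finset.mem_subtype, Nat.lt_succ_iff] using hl
    have := hL l.1 h1
    exact Subsingleton.elim _ _

/-- Under either finiteness hypothesis, conjugacy to the partial normal forms modulo every
`O(m + 1)` is realized by a single formal mapping. -/
theorem IsPartialNormalForms.exists_conjMod {R : Representatives B} {c : CalH1Hat N₁}
    {N : ℕ → Moduli N₁} (h : IsPartialNormalForms R c N)
    (hfin : FiniteDimensional ℂ (CalH1 N₁) ∨ Subsingleton (CalH0 N₁)) {Φ : Moduli N₁}
    (hΦ : ∀ m, 1 ≤ m → EquivMod m Φ (N m)) :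
    ∃ F : FormalMap 𝒰 d, ∀ m, ConjMod m F Φ.1.toFun (N m).1.toFun := by
  rcases hfin with hfin | hfin
  · obtain ⟨L, hL, hsub⟩ := exists_subsingleton_H1 (N₁ := N₁)
    exact exists_conjMod_of_H1 hL hsub (fun m hm k j z hz => h.ordAt_sub hm hz) (hΦ L hL)
  · exact exists_conjMod_of_H0 (eq_zero_of_subsingleton_calH0 hfin)
      (fun m hm k j z hz => h.ordAt_sub hm hz) hΦ

end FormalNbhd

theorem mainTheorem2 {n d : ℕ} {C : Type*} [TopologicalSpace C] [T2Space C] [CompactSpace C]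
    [ChartedSpace (Fin n → ℂ) C] [IsManifold 𝓘(ℂ, Fin n → ℂ) ω C]
    {ι : Type*} [Finite ι] (𝒰 : FormalNbhd.PolydiscCover n C ι)
    (N₁ : FormalNbhd.Neighborhood 𝒰 d) (B : FormalNbhd.CocycleBasis N₁) :
    Equivalence (FormalNbhd.FormalEquiv N₁) ∧
    Nonempty (FormalNbhd.Representatives B) ∧
    ∀ R : FormalNbhd.Representatives B,
      ∃ (𝔆 : Quot (FormalNbhd.FormalEquiv N₁) → FormalNbhd.CalH1Hat N₁)
        (Ninf : FormalNbhd.Moduli N₁ → FormalNbhd.FormalTransition 𝒰 d),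
        (∀ Φ, Ninf Φ ∈ FormalNbhd.NormalForms R) ∧
        (∀ Φ c P, FormalNbhd.IsNormalFormOf R Φ c P ↔ c = 𝔆 (Quot.mk _ Φ) ∧ P = Ninf Φ) ∧
        (FiniteDimensional ℂ (FormalNbhd.CalH1 N₁) ∨ Subsingleton (FormalNbhd.CalH0 N₁) →
          Function.Injective 𝔆 ∧
          ∀ Φ, ∃ F : FormalNbhd.FormalMap 𝒰 d, FormalNbhd.Transforms F Φ (Ninf Φ)) ∧
        (FiniteDimensional ℂ (FormalNbhd.CalH1 N₁) →
          ∃ 𝔆₀ : Quot (FormalNbhd.FormalEquiv N₁) → FormalNbhd.CalH1 N₁,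
            Function.Injective 𝔆₀ ∧ ∀ x l, 𝔆₀ x l = 𝔆 x l) := by
  refine ⟨FormalNbhd.formalEquiv_equivalence N₁, FormalNbhd.nonempty_representatives B,
    fun R => ?_⟩
  choose c P hcP using R.exists_isNormalFormOf
  have hinj : FiniteDimensional ℂ (FormalNbhd.CalH1 N₁) ∨ Subsingleton (FormalNbhd.CalH0 N₁) →
      ∀ Φ Ψ, c Φ = c Ψ → FormalNbhd.FormalEquiv N₁ Φ Ψ := by
    intro hfin Φ Ψ hΦΨ
    obtain ⟨N, hN, -, hΦ⟩ := hcP Φ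
    obtain ⟨N', hN', -, hΨ⟩ := hcP Ψ
    rw [← hΦΨ] at hN'
    obtain ⟨F, hF⟩ := hN.exists_conjMod hfin hΦ
    obtain ⟨G, hG⟩ := hN.exists_conjMod hfin fun m hm => hN.eq_of_class_eq hN' hm ▸ hΨ m hm
    exact FormalNbhd.formalEquiv_of_conjMod hF hG
  have hlift : ∀ Φ Ψ, FormalNbhd.FormalEquiv N₁ Φ Ψ → c Φ = c Ψ := by
    rintro Φ Ψ ⟨F, hF⟩
    exact ((hcP Φ).unique (hcP Ψ) fun m => ⟨F, hF m⟩).1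
  have hinj' : FiniteDimensional ℂ (FormalNbhd.CalH1 N₁) ∨ Subsingleton (FormalNbhd.CalH0 N₁) →
      Function.Injective (Quot.lift c hlift) := by
    rintro hfin ⟨Φ⟩ ⟨Ψ⟩ h
    exact Quot.sound (hinj hfin Φ Ψ h)
  refine ⟨Quot.lift c hlift, P, fun Φ => ?_, fun Φ c' P' => ⟨fun h => ?_, ?_⟩,
    fun hfin => ⟨hinj' hfin, fun Φ => ?_⟩, fun hfin => ?_⟩
  · obtain ⟨N, hN, hP, -⟩ := hcP Φ
    exact ⟨c Φ, N, hN, hP⟩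
  · exact h.unique (hcP Φ) fun m => .refl m Φ
  · rintro ⟨rfl, rfl⟩
    exact hcP Φ
  · obtain ⟨N, hN, hP, hΦ⟩ := hcP Φ
    obtain ⟨F, hF⟩ := hN.exists_conjMod hfin hΦ
    exact ⟨F, hP.transforms hF⟩
  · choose x hx using FormalNbhd.exists_calH1_apply_eq (N₁ := N₁)
    refine ⟨fun q => x (Quot.lift c hlift q), fun q q' h => hinj' (.inl hfin) ?_,
      fun q l => hx _ l⟩
    funext l
    rw [← hx (Quot.lift c hlift q), ← hx (Quot.lift c hlift q')]
    exact congrArg (fun y : FormalNbhd.CalH1 N₁ => y l) h
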